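/- Let $A$ be an alphabet. The letters of a word $u\in A^*$ sit at the positions $1,\dots,|u|$; write $u[i]$ for the letter at position $i$. **Logic.** $\mathrm{FO}^2_{m,n}$ is the set of first-order sentences over words (atomic formulas: "position $x$ carries the letter $a$" for $a\in A$, $x<y$, and $x=y$) that use at most two variable symbols, have negations only on atomic formulas, have quantifier depth at most $n$, and have at most $m$ blocks. The last condition means that along every root-to-leaf path of the parsing tree the sequence of quantifiers has at most $m$ maximal factors consisting only of $\exists$ or only of $\forall$. **Rankers.** A ranker is a non-empty word over $\{\mathsf X_a,\mathsf Y_a\mid a\in A\}$. For an integer $q$, $\mathsf X_a(u,q)$ is the least $i$ with $q<i\le|u|$ and $u[i]=a$, and $\mathsf Y_a(u,q)$ is the greatest $i$ with $1\le i<q$ and $u[i]=a$; each is undefined if no such $i$ exists. A ranker $r=\mathsf Z_1\cdots\mathsf Z_k$ is executed on $u$ from left to right, starting at position $0$ if $\mathsf Z_1$ is an $\mathsf X$-letter and at position $|u|+1$ if $\mathsf Z_1$ is a $\mathsf Y$-letter; it is defined on $u$ if all its steps are defined, and then $r(u)$ is the last position reached. The depth of $r$ is its length $k$, and its number of blocks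 is the number of maximal factors of $r$ consisting only of $\mathsf X$-letters or only of $\mathsf Y$-letters. Let $\underline R_{m,n}$ be the set of rankers with at most $m$ blocks and depth at most $n$ (so $\underline R_{0,n}=\emptyset$). **Condensed rankers.** The ranker $r=\mathsf Z_1\cdots\mathsf Z_k$ is condensed on $u$ if it is defined on $u$ and there is a strictly decreasing chain of open intervals $$(0,|u|+1)=(i_0,j_0)\supsetneq(i_1,j_1)\supsetneq\cdots\supsetneq(i_{k-1},j_{k-1})\ni r(u)$$ such that for all $1\le\ell\le k-1$: - if $\mathsf Z_\ell\mathsf Z_{\ell+1}=\mathsf X_a\mathsf X_b$, then $(i_\ell,j_\ell)=(\mathsf X_a(u,i_{\ell-1}),\,j_{\ell-1})$; - if $\mathsf Z_\ell\mathsf Z_{\ell+1}=\mathsf Y_a\mathsf Y_b$, then $(i_\ell,j_\ell)=(i_{\ell-1},\,\mathsf Y_a(u,j_{\ell-1}))$; - if $\mathsf Z_\ell\mathsf Z_{\ell+1}=\mathsf X_a\mathsf Y_b$, then $(i_\ell,j_\ell)=(i_{\ell-1},\,\mathsf X_a(u,i_{\ell-1}))$; - if $\mathsf Z_\ell\mathsf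 Z_{\ell+1}=\mathsf Y_a\mathsf X_b$, then $(i_\ell,j_\ell)=(\mathsf Y_a(u,j_{\ell-1}),\,j_{\ell-1})$. For integers $x,y$ let $\mathsf{ord}(x,y)\in\{<,=,>\}$ be their order type. **Theorem.** Let $u,v\in A^*$ and $1\le m\le n$. Then $u$ and $v$ satisfy the same sentences in $\mathrm{FO}^2_{m,n}$ if and only if the following three conditions hold. - (WI 1c) $u$ and $v$ agree on condensed rankers from $\underline R_{m,n}$: every $r\in\underline R_{m,n}$ is condensed on $u$ if and only if it is condensed on $v$. - (WI 2c) If $r\in\underline R_{m,n}$ and $r'\in\underline R_{m-1,n-1}$ are condensed on both $u$ and $v$, then $\mathsf{ord}(r(u),r'(u))=\mathsf{ord}(r(v),r'(v))$. - (WI 3c) If $r\in\underline R_{m,n}$ and $r'\in\underline R_{m,n-1}$ are condensed on both $u$ and $v$ and end with letters of different directions (one with an $\mathsf X$-letter, the other with a $\mathsf Y$-letter), then $\mathsf{ord}(r(u),r'(u))=\mathsf{ord}(r(v),r'(v))$. -/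

import Mathlib

namespace CondensedRanker

/-- The number of blocks (maximal constant factors) of a word. -/
def blockCount {α : Type*} [DecidableEq α] : List α → ℕ
  | [] => 0
  | [_] => 1
  | a :: b :: l => if a = b then blockCount (b :: l) else blockCount (b :: l) + 1

/-- `HasLetter u i a`: the position `i` of the word `u` carries the letter `a`, i.e. `u[i] = a`.
Positions are numbered from `1` to `|u|`. -/
def HasLetter {A : Type*} (u : List A) (i : ℕ) (a : A) : Prop :=
  1 ≤ i ∧ u[i - 1]? = some a

/-! ### Two-variable first-order logic over words -/

/-- The two quantifiers. -/
inductive Quant where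
  | ex
  | all
deriving DecidableEq

/-- Atomic formulas in the two variable symbols `0, 1 : Fin 2`. -/
inductive Atom (A : Type*) where
  | letter (a : A) (x : Fin 2)
  | lt (x y : Fin 2)
  | eq (x y : Fin 2)

/-- First-order formulas with two (reusable) variable symbols, in which negation is applied to
atomic formulas only. -/
inductive Formula (A : Type*) where
  | atom (α : Atom A)
  | natom (α : Atom A)
  | and (φ ψ : Formula A)
  | or (φ ψ : Formula A)
  | ex (x : Fin 2) (φ : Formula A)
  | all (x : Fin 2) (φ : Formula A)

/-- The variables of an atomic formula. -/
def Atom.vars {A : Type*} : Atom A → Set (Fin 2)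
  | .letter _ x => {x}
  | .lt x y => {x, y}
  | .eq x y => {x, y}

/-- The free variables of a formula. -/
def Formula.freeVars {A : Type*} : Formula A → Set (Fin 2)
  | .atom α => α.vars
  | .natom α => α.vars
  | .and φ ψ => φ.freeVars ∪ ψ.freeVars
  | .or φ ψ => φ.freeVars ∪ ψ.freeVars
  | .ex x φ => φ.freeVars \ {x}
  | .all x φ => φ.freeVars \ {x}

/-- The quantifier labels of the paths from the root to the leaves of the parsing tree. -/
def Formula.labels {A : Type*} : Formula A → List (List Quant)
  | .atom _ => [[]]
  | .natom _ => [[]]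
  | .and φ ψ => φ.labels ++ ψ.labels
  | .or φ ψ => φ.labels ++ ψ.labels
  | .ex _ φ => φ.labels.map (Quant.ex :: ·)
  | .all _ φ => φ.labels.map (Quant.all :: ·)

/-- Truth of an atomic formula in `u` when the variable `x` denotes the position `σ x`. -/
def Atom.Holds {A : Type*} (u : List A) (σ : Fin 2 → ℕ) : Atom A → Prop
  | .letter a x => HasLetter u (σ x) a
  | .lt x y => σ x < σ y
  | .eq x y => σ x = σ y

/-- Truth of a formula in `u` under an assignment; quantifiers range over `{1, …, |u|}`. -/
def Formula.Holds {A : Type*} (u : List A) : (Fin 2 → ℕ) → Formula A → Prop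
  | σ, .atom α => α.Holds u σ
  | σ, .natom α => ¬ α.Holds u σ
  | σ, .and φ ψ => φ.Holds u σ ∧ ψ.Holds u σ
  | σ, .or φ ψ => φ.Holds u σ ∨ ψ.Holds u σ
  | σ, .ex x φ => ∃ i ∈ Set.Icc 1 u.length, φ.Holds u (Function.update σ x i)
  | σ, .all x φ => ∀ i ∈ Set.Icc 1 u.length, φ.Holds u (Function.update σ x i)

/-- The word `u` satisfies `φ`. This is used for sentences only, whose truth value does not depend
on the assignment, so that the value `0` of the assignment plays no role. -/
def Satisfies {A : Type*} (u : List A) (φ : Formula A) : Prop :=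
  φ.Holds u (fun _ => 0)

/-- The sentences of two-variable first-order logic over words with quantifier depth at most `n`
and with at most `m` blocks. -/
def FO2 (A : Type*) (m n : ℕ) : Set (Formula A) :=
  {φ | φ.freeVars = ∅ ∧ ∀ l ∈ φ.labels, l.length ≤ n ∧ blockCount l ≤ m}

/-! ### Rankers -/

/-- The two directions: `X` goes to the right, `Y` goes to the left. -/
inductive Dir where
  | X
  | Y
deriving DecidableEq

/-- Words on the alphabet `{X_a, Y_a | a ∈ A}`. The rankers are the non-empty ones. -/
abbrev RankerWord (A : Type*) := List (Dir × A)

/-- `Next u (X, a) q p`: the position `X_a(u, q)` is defined and equal to `p`; it is the least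
`a`-position to the right of `q`. Dually, `Next u (Y, a) q p` means that `p = Y_a(u, q)` is the
greatest `a`-position to the left of `q`. -/
def Next {A : Type*} (u : List A) : Dir × A → ℕ → ℕ → Prop
  | (.X, a), q, p => IsLeast {i | q < i ∧ HasLetter u i a} p
  | (.Y, a), q, p => IsGreatest {i | i < q ∧ HasLetter u i a} p

/-- `Reaches u r q p`: executing the instructions of `r` from left to right, starting at `q`, every
instruction is defined and the last position visited is `p`, i.e. `r(u, q) = p`. -/
def Reaches {A : Type*} (u : List A) : RankerWord A → ℕ → ℕ → Prop
  | [], q, p => p = q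
  | z :: r, q, p => ∃ q', Next u z q q' ∧ Reaches u r q' p

/-- `Defines u r p`: the ranker `r` is defined on `u` and `r(u) = p`. -/
def Defines {A : Type*} (u : List A) : RankerWord A → ℕ → Prop
  | [], _ => False
  | (.X, a) :: r, p => Reaches u ((.X, a) :: r) 0 p
  | (.Y, a) :: r, p => Reaches u ((.Y, a) :: r) (u.length + 1) p

/-- The rankers with at most `m` blocks and of depth (length) at most `n`. -/
def rankers (A : Type*) (m n : ℕ) : Set (RankerWord A) :=
  {r | r ≠ [] ∧ blockCount (r.map Prod.fst) ≤ m ∧ r.length ≤ n}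

/-- The passage from the open interval `I = (i, j)` to the next one `J = (i', j')`, when the current
instruction is the first argument and the direction of the following one is the second:
`(X_a(u, i), j)` for `X_a X_b`, `(i, Y_a(u, j))` for `Y_a Y_b`, `(i, X_a(u, i))` for `X_a Y_b`,
and `(Y_a(u, j), j)` for `Y_a X_b`. -/
def ZoomStep {A : Type*} (u : List A) : Dir × A → Dir → ℕ × ℕ → ℕ × ℕ → Prop
  | (.X, a), .X, I, J => Next u (.X, a) I.1 J.1 ∧ J.2 = I.2
  | (.Y, a), .Y, I, J => J.1 = I.1 ∧ Next u (.Y, a) I.2 J.2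
  | (.X, a), .Y, I, J => J.1 = I.1 ∧ Next u (.X, a) I.1 J.2
  | (.Y, a), .X, I, J => Next u (.Y, a) I.2 J.1 ∧ J.2 = I.2

/-- The ranker `r = Z_1 ⋯ Z_k` is condensed on `u`: it is defined on `u`, and there is a chain of
open intervals `(0, |u| + 1) = I_0 ⊃ I_1 ⊃ ⋯ ⊃ I_{k-1} ∋ r(u)` following the rules of `ZoomStep`.
(Here `r[l]` is `Z_{l+1}`.) -/
def IsCondensed {A : Type*} (u : List A) (r : RankerWord A) : Prop :=
  ∃ p, Defines u r p ∧ ∃ I : ℕ → ℕ × ℕ,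
    I 0 = (0, u.length + 1) ∧
    (∀ (l : ℕ) (h : l + 1 < r.length),
      Set.Ioo (I (l + 1)).1 (I (l + 1)).2 ⊂ Set.Ioo (I l).1 (I l).2 ∧
      ZoomStep u r[l] (r[l + 1]).1 (I l) (I (l + 1))) ∧
    p ∈ Set.Ioo (I (r.length - 1)).1 (I (r.length - 1)).2

/-- `ord(r(u), r'(u)) = ord(r(v), r'(v))`, where `ord` is the order type of two integers; used for
rankers `r`, `r'` that are defined on `u` and `v`. -/
def SameOrd {A : Type*} (u v : List A) (r r' : RankerWord A) : Prop :=
  ∀ p p' q q' : ℕ, Defines u r p → Defines u r' p' → Defines v r q → Defines v r' q' →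
    compare p p' = compare q q'

/-- Two rankers end with different direction letters. -/
def EndDifferently {A : Type*} (r r' : RankerWord A) : Prop :=
  r.getLast?.map Prod.fst ≠ r'.getLast?.map Prod.fst

end CondensedRanker

/-! Both sides of the equivalence are compared with an Ehrenfeucht–Fraïssé game `Sim` that keeps one
pebble on each word. One pebble suffices because requantifying one of two variables forgets its old
position: a move only has to respect the order relative to the other variable. The number of blocks
of a formula corresponds to the number of times Spoiler changes the word. Thus equivalence for the
fragment means that Duplicator wins whichever word Spoiler starts on (`equiv_iff_sim`). Separating
formulas are conjunctions over the positions of a word, so the alphabet may be infinite.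

From the game to rankers: let Spoiler move to the value of a ranker in `u`. By induction on the
ranker, Duplicator's reply lies beyond the value in `v` of the ranker without its last letter, and
carries that last letter; hence the ranker's value in `v` is no later than the reply, in the
direction of that letter (`PreservesSides.reply`, `preservesSides`). One more move compares two
rankers (`sameSide_of_sim`). Condensedness is such a comparison too, because the far end of each
interval is the value of a shorter ranker with fewer blocks (`Zoom.condensedAt_far`,
`blocks_farPrefix_lt`), or lies just outside the word.

From rankers to the game: Duplicator maintains `Similar`, which constrains the pebbles by condensed
rankers. If Spoiler's position is the value of a ranker with fewer blocks, Duplicator uses the same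
ranker. Otherwise he approximates that position, coming from the side away from the old pebble, by a
condensed ranker ending with its letter (`exists_condensed_approximation`, `Similar.reply`). The
remaining work identifies the chain of intervals with a recursion on the reversed ranker. -/

namespace CondensedRanker

variable {A : Type*}

/-! ### The game -/

/-- The pairs `(i, i')` and `(j, j')` have the same order type. -/
def SameSide (i i' j j' : ℕ) : Prop :=
  (i < i' ↔ j < j') ∧ (i' < i ↔ j' < j)

/-- Position `i` of `u` and position `j` of `v` carry the same letters. -/
def SameLetters (u : List A) (i : ℕ) (v : List A) (j : ℕ) : Prop :=
  ∀ a, HasLetter u i a ↔ HasLetter v j a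

/-- Duplicator wins the `n`-round game with one pebble on each word, when Spoiler plays on `u` first
and changes the word fewer than `m` times. -/
def Sim : ℕ → ℕ → List A → ℕ → List A → ℕ → Prop
  | _, 0, u, i, v, j => SameLetters u i v j
  | m, n + 1, u, i, v, j => SameLetters u i v j ∧
      (∀ i' ∈ Set.Icc 1 u.length, ∃ j' ∈ Set.Icc 1 v.length,
        SameSide i i' j j' ∧ Sim m n u i' v j') ∧
      (2 ≤ m → ∀ j' ∈ Set.Icc 1 v.length, ∃ i' ∈ Set.Icc 1 u.length,
        SameSide j j' i i' ∧ Sim (m - 1) n v j' u i')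

theorem SameSide.symm {i i' j j' : ℕ} (h : SameSide i i' j j') : SameSide j j' i i' :=
  ⟨h.1.symm, h.2.symm⟩

theorem SameLetters.symm {u v : List A} {i j : ℕ} (h : SameLetters u i v j) :
    SameLetters v j u i := fun a => (h a).symm

theorem Sim.sameLetters {m n : ℕ} {u v : List A} {i j : ℕ} (h : Sim m n u i v j) :
    SameLetters u i v j := by
  cases n with
  | zero => exact h
  | succ n => exact h.1

/-- Making Spoiler begin on the other word is a change of word, and it is paid for with one block.
-/
theorem Sim.switch {m n : ℕ} {u v : List A} {i j : ℕ} (h : Sim m n u i v j) (hm : 2 ≤ m) :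
    Sim (m - 1) n v j u i := by
  induction n generalizing m u v i j with
  | zero => exact h.symm
  | succ n ih =>
    refine ⟨h.1.symm, h.2.2 hm, fun hm' i' hi' => ?_⟩
    obtain ⟨j', hj', hs, hsim⟩ := h.2.1 i' hi'
    exact ⟨j', hj', hs, ih (ih hsim hm) hm'⟩

theorem Sim.mono {m n n' : ℕ} {u v : List A} {i j : ℕ} (h : Sim m n u i v j) (hn : n' ≤ n) :
    Sim m n' u i v j := by
  induction n' generalizing m n u v i j with
  | zero => exact h.sameLetters
  | succ n' ih =>
    obtain _ | n := n
    · omega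
    refine ⟨h.1, fun i' hi' => ?_, fun hm j' hj' => ?_⟩
    · obtain ⟨j', hj', hs, hsim⟩ := h.2.1 i' hi'
      exact ⟨j', hj', hs, ih hsim (by omega)⟩
    · obtain ⟨i', hi', hs, hsim⟩ := h.2.2 hm j' hj'
      exact ⟨i', hi', hs, ih hsim (by omega)⟩

/-! ### Fragments of the logic -/

/-- The other quantifier. -/
def Quant.dual : Quant → Quant
  | .ex => .all
  | .all => .ex

/-- The formulas of depth at most `n` which still have at most `m` blocks when they are put below a
quantifier `s`. -/
def Frag (s : Quant) (m n : ℕ) (φ : Formula A) : Prop :=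
  ∀ l ∈ φ.labels, l.length ≤ n ∧ blockCount (s :: l) ≤ m

theorem blockCount_cons_self {α : Type*} [DecidableEq α] (a : α) (l : List α) :
    blockCount (a :: a :: l) = blockCount (a :: l) := by
  simp [blockCount]

theorem blockCount_cons_of_ne {α : Type*} [DecidableEq α] {a b : α} (h : a ≠ b) (l : List α) :
    blockCount (a :: b :: l) = blockCount (b :: l) + 1 := by
  simp [blockCount, h]

theorem blockCount_le_cons {α : Type*} [DecidableEq α] (a : α) (l : List α) :
    blockCount l ≤ blockCount (a :: l) := by
  rcases l with _ | ⟨b, l⟩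
  · simp [blockCount]
  · simp only [blockCount]; split <;> omega

theorem blockCount_cons_le {α : Type*} [DecidableEq α] (a : α) (l : List α) :
    blockCount (a :: l) ≤ blockCount l + 1 := by
  rcases l with _ | ⟨b, l⟩
  · simp [blockCount]
  · simp only [blockCount]; split <;> omega

theorem blockCount_cons_pos {α : Type*} [DecidableEq α] (a : α) (l : List α) :
    1 ≤ blockCount (a :: l) := by
  induction l generalizing a with
  | nil => simp [blockCount]
  | cons b l ih => exact (ih b).trans (blockCount_le_cons _ _)

theorem labels_ne_nil (φ : Formula A) : φ.labels ≠ [] := by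
  induction φ <;> simp_all [Formula.labels]

theorem frag_and {s : Quant} {m n : ℕ} {φ ψ : Formula A} :
    Frag s m n (.and φ ψ) ↔ Frag s m n φ ∧ Frag s m n ψ := by
  simp only [Frag, Formula.labels]
  exact List.forall_mem_append

theorem frag_or {s : Quant} {m n : ℕ} {φ ψ : Formula A} :
    Frag s m n (.or φ ψ) ↔ Frag s m n φ ∧ Frag s m n ψ := by
  simp only [Frag, Formula.labels]
  exact List.forall_mem_append

theorem Frag.switch {s : Quant} {m n : ℕ} {φ : Formula A} (h : Frag s m n φ) (t : Quant) :
    Frag t (m + 1) n φ := fun l hl =>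
  ⟨(h l hl).1, (blockCount_cons_le _ _).trans
    (by have := (h l hl).2; have := blockCount_le_cons s l; omega)⟩

theorem frag_ex {m n : ℕ} {x : Fin 2} {φ : Formula A} :
    Frag .ex m (n + 1) (.ex x φ) ↔ Frag .ex m n φ := by
  simp [Frag, Formula.labels, blockCount_cons_self]

theorem Frag.of_ex {s : Quant} {m n : ℕ} {x : Fin 2} {φ : Formula A}
    (h : Frag s m n (.ex x φ)) :
    ∃ n', n = n' + 1 ∧ (s = .ex ∧ Frag .ex m n' φ ∨
      s = .all ∧ 2 ≤ m ∧ Frag .ex (m - 1) n' φ) := by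
  have key : ∀ l ∈ φ.labels, l.length + 1 ≤ n ∧ blockCount (s :: .ex :: l) ≤ m := fun l hl => by
    simpa using h (.ex :: l) (List.mem_map_of_mem hl)
  -- Some path exists; it forces the depth to be positive and, if the quantifier changes, `m` to be
  -- at least 2.
  obtain ⟨l₀, hl₀⟩ := List.exists_mem_of_ne_nil _ (labels_ne_nil φ)
  obtain ⟨n', rfl⟩ : ∃ n', n = n' + 1 := ⟨n - 1, by have := (key l₀ hl₀).1; omega⟩
  refine ⟨n', rfl, ?_⟩
  cases s
  · refine .inl ⟨rfl, fun l hl => ⟨by have := (key l hl).1; omega, ?_⟩⟩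
    simpa [blockCount_cons_self] using (key l hl).2
  · have key' : ∀ l ∈ φ.labels, blockCount (Quant.ex :: l) + 1 ≤ m := fun l hl => by
      have := (key l hl).2
      rwa [blockCount_cons_of_ne (by decide)] at this
    refine .inr ⟨rfl, ?_, fun l hl => ⟨by have := (key l hl).1; omega, ?_⟩⟩
    · have := key' l₀ hl₀
      have := blockCount_cons_pos Quant.ex l₀
      omega
    · have := key' l hl
      omega

/-- The negation of a formula, in negation normal form. -/
def Formula.neg : Formula A → Formula A
  | .atom α => .natom α
  | .natom α => .atom α
  | .and φ ψ => .or φ.neg ψ.neg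
  | .or φ ψ => .and φ.neg ψ.neg
  | .ex x φ => .all x φ.neg
  | .all x φ => .ex x φ.neg

theorem holds_neg (u : List A) (σ : Fin 2 → ℕ) (φ : Formula A) :
    φ.neg.Holds u σ ↔ ¬ φ.Holds u σ := by
  induction φ generalizing σ with
  | atom α => rfl
  | natom α => simp [Formula.neg, Formula.Holds]
  | and φ ψ ih₁ ih₂ => simp only [Formula.neg, Formula.Holds, ih₁, ih₂]; tauto
  | or φ ψ ih₁ ih₂ => simp only [Formula.neg, Formula.Holds, ih₁, ih₂]; tauto
  | ex x φ ih => simp only [Formula.neg, Formula.Holds, ih]; push Not; rfl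
  | all x φ ih => simp only [Formula.neg, Formula.Holds, ih]; push Not; rfl

theorem freeVars_neg (φ : Formula A) : φ.neg.freeVars = φ.freeVars := by
  induction φ <;> simp_all [Formula.neg, Formula.freeVars]

theorem labels_neg (φ : Formula A) : φ.neg.labels = φ.labels.map (List.map Quant.dual) := by
  induction φ <;> simp_all [Formula.neg, Formula.labels, Quant.dual]

theorem neg_neg (φ : Formula A) : φ.neg.neg = φ := by
  induction φ <;> simp_all [Formula.neg]

theorem blockCount_map {α β : Type*} [DecidableEq α] [DecidableEq β] {f : α → β}
    (hf : f.Injective) (l : List α) : blockCount (l.map f) = blockCount l := by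
  induction l with
  | nil => rfl
  | cons a l ih =>
    rcases l with _ | ⟨b, l⟩
    · rfl
    · simp only [List.map_cons, blockCount, hf.eq_iff] at ih ⊢
      rw [ih]

theorem Quant.dual_injective : Quant.dual.Injective := by
  intro a b; cases a <;> cases b <;> simp [Quant.dual]

theorem Frag.neg {s : Quant} {m n : ℕ} {φ : Formula A} (h : Frag s m n φ) :
    Frag s.dual m n φ.neg := by
  intro l hl
  rw [labels_neg, List.mem_map] at hl
  obtain ⟨l, hl, rfl⟩ := hl
  rw [← List.map_cons, blockCount_map Quant.dual_injective, List.length_map]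
  exact h l hl

theorem Frag.of_all {s : Quant} {m n : ℕ} {x : Fin 2} {φ : Formula A}
    (h : Frag s m n (.all x φ)) :
    ∃ n', n = n' + 1 ∧ (s = .all ∧ Frag .all m n' φ ∨
      s = .ex ∧ 2 ≤ m ∧ Frag .all (m - 1) n' φ) := by
  obtain ⟨n', rfl, ⟨hs, hf⟩ | ⟨hs, hm, hf⟩⟩ := Frag.of_ex (φ := φ.neg) h.neg
  · refine ⟨n', rfl, .inl ⟨by cases s <;> simp_all [Quant.dual], ?_⟩⟩
    simpa [neg_neg, Quant.dual] using hf.neg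
  · refine ⟨n', rfl, .inr ⟨by cases s <;> simp_all [Quant.dual], hm, ?_⟩⟩
    simpa [neg_neg, Quant.dual] using hf.neg

/-! ### Duplicator's strategies preserve formulas -/

theorem holds_iff_of_atom {u v : List A} {σ τ : Fin 2 → ℕ}
    (hl : ∀ x, SameLetters u (σ x) v (τ x)) (hs : ∀ x y, SameSide (σ x) (σ y) (τ x) (τ y))
    (α : Atom A) : α.Holds u σ ↔ α.Holds v τ := by
  cases α with
  | letter a x => exact hl x a
  | lt x y => exact (hs x y).1
  | eq x y => have := hs x y; simp only [Atom.Holds, SameSide] at *; omega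

/-- `SideSim s` is `Sim` with Spoiler starting on the left word for `∃` and on the right word
for `∀`. -/
def SideSim (s : Quant) (m n : ℕ) (u : List A) (i : ℕ) (v : List A) (j : ℕ) : Prop :=
  match s with
  | .ex => Sim m n u i v j
  | .all => Sim m n v j u i

theorem SideSim.sameLetters {s : Quant} {m n : ℕ} {u v : List A} {i j : ℕ}
    (h : SideSim s m n u i v j) : SameLetters u i v j := by
  cases s
  · exact Sim.sameLetters h
  · exact (Sim.sameLetters h).symm

theorem sameSide_update {σ τ : Fin 2 → ℕ} {x : Fin 2} {i j : ℕ}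
    (h : SameSide (σ (1 - x)) i (τ (1 - x)) j) (y z : Fin 2) :
    SameSide (Function.update σ x i y) (Function.update σ x i z)
      (Function.update τ x j y) (Function.update τ x j z) := by
  unfold SameSide at *
  fin_cases x <;> fin_cases y <;> fin_cases z <;>
    simp [Function.update] at * <;> omega

/-- An `∃` is answered by moving its witness from `u` to `v`, a `∀` by moving a challenge from `v`
to `u`. A quantifier other than `s` starts a block, and Spoiler then changes the word. -/
theorem SideSim.holds {s : Quant} {m n : ℕ} {u v : List A} {σ τ : Fin 2 → ℕ} {φ : Formula A}
    (hφ : Frag s m n φ) (h : ∀ x, SideSim s m n u (σ x) v (τ x))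
    (hs : ∀ x y, SameSide (σ x) (σ y) (τ x) (τ y)) (hu : φ.Holds u σ) : φ.Holds v τ := by
  have upd : ∀ {t : Quant} {k l i j : ℕ} {σ τ : Fin 2 → ℕ} (x : Fin 2),
      (∀ y, SideSim t k l u (σ y) v (τ y)) → SideSim t k l u i v j →
      ∀ y, SideSim t k l u (Function.update σ x i y) v (Function.update τ x j y) := by
    intro t k l i j σ τ x h₁ h₂ y
    by_cases hy : y = x
    · subst hy; simpa using h₂
    · simpa [Function.update_of_ne hy] using h₁ y
  induction φ generalizing s m n σ τ with
  | atom α => exact (holds_iff_of_atom (fun x => (h x).sameLetters) hs α).1 hu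
  | natom α => exact fun h' => hu ((holds_iff_of_atom (fun x => (h x).sameLetters) hs α).2 h')
  | and φ ψ ih₁ ih₂ =>
    rw [frag_and] at hφ
    exact ⟨ih₁ hφ.1 h hs hu.1, ih₂ hφ.2 h hs hu.2⟩
  | or φ ψ ih₁ ih₂ =>
    rw [frag_or] at hφ
    exact hu.imp (ih₁ hφ.1 h hs) (ih₂ hφ.2 h hs)
  | ex x φ ih =>
    obtain ⟨i, hi, hu⟩ := hu
    obtain ⟨n, rfl, ⟨rfl, hf⟩ | ⟨rfl, hm, hf⟩⟩ := hφ.of_ex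
    -- The move is played from the pebble of the other variable `1 - x`, since the old value of `x`
    -- is lost.
    · obtain ⟨j, hj, hss, hsim⟩ := (h (1 - x)).2.1 i hi
      refine ⟨j, hj, ih hf (upd x (fun y => ?_) hsim) (sameSide_update hss) hu⟩
      exact Sim.mono (h y) (by omega)
    · obtain ⟨j, hj, hss, hsim⟩ := (h (1 - x)).2.2 hm i hi
      refine ⟨j, hj, ih hf (upd x (fun y => ?_) hsim) (sameSide_update hss) hu⟩
      exact (Sim.mono (h y) (by omega)).switch hm
  | all x φ ih =>
    intro j hj
    obtain ⟨n, rfl, ⟨rfl, hf⟩ | ⟨rfl, hm, hf⟩⟩ := hφ.of_all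
    · obtain ⟨i, hi, hss, hsim⟩ := (h (1 - x)).2.1 j hj
      refine ih hf (upd x (fun y => ?_) hsim) (sameSide_update hss.symm) (hu i hi)
      exact Sim.mono (h y) (by omega)
    · obtain ⟨i, hi, hss, hsim⟩ := (h (1 - x)).2.2 hm j hj
      refine ih hf (upd x (fun y => ?_) hsim) (sameSide_update hss.symm) (hu i hi)
      exact (Sim.mono (h y) (by omega)).switch hm

/-- The outermost quantifiers may be of both kinds, so both games are needed. Below the Boolean
combination at the root, `s` is chosen equal to the first quantifier and costs no block. Position 0
is a dummy pebble to the left of the word. -/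
theorem holds_of_sim_zero {m n : ℕ} {u v : List A} (h : Sim m n u 0 v 0) (h' : Sim m n v 0 u 0)
    {φ : Formula A} (hφ : ∀ l ∈ φ.labels, l.length ≤ n ∧ blockCount l ≤ m)
    (hu : Satisfies u φ) : Satisfies v φ := by
  have hs : ∀ x y : Fin 2, SameSide ((fun _ => 0 : Fin 2 → ℕ) x) ((fun _ => 0 : Fin 2 → ℕ) y)
    ((fun _ => 0 : Fin 2 → ℕ) x) ((fun _ => 0 : Fin 2 → ℕ) y) := fun x y => ⟨Iff.rfl, Iff.rfl⟩
  unfold Satisfies at *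
  induction φ with
  | atom α => exact (holds_iff_of_atom (fun _ => h.sameLetters) hs α).1 hu
  | natom α => exact fun h' => hu ((holds_iff_of_atom (fun _ => h.sameLetters) hs α).2 h')
  | and φ ψ ih₁ ih₂ =>
    simp only [Formula.labels, List.mem_append, or_imp, forall_and] at hφ ih₁ ih₂
    exact ⟨ih₁ ⟨hφ.1.1, hφ.2.1⟩ hu.1, ih₂ ⟨hφ.1.2, hφ.2.2⟩ hu.2⟩
  | or φ ψ ih₁ ih₂ =>
    simp only [Formula.labels, List.mem_append, or_imp, forall_and] at hφ ih₁ ih₂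
    exact hu.imp (ih₁ ⟨hφ.1.1, hφ.2.1⟩) (ih₂ ⟨hφ.1.2, hφ.2.2⟩)
  | ex x φ =>
    refine SideSim.holds (s := .ex) (m := m) (n := n) ?_ (fun _ => h) hs hu
    intro l hl
    refine ⟨(hφ l hl).1, ?_⟩
    have := (hφ l hl).2
    obtain ⟨l, -, rfl⟩ := List.mem_map.1 hl
    rwa [blockCount_cons_self]
  | all x φ =>
    refine SideSim.holds (s := .all) (m := m) (n := n) ?_ (fun _ => h') hs hu
    intro l hl
    refine ⟨(hφ l hl).1, ?_⟩
    have := (hφ l hl).2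
    obtain ⟨l, -, rfl⟩ := List.mem_map.1 hl
    rwa [blockCount_cons_self]

/-! ### Spoiler's strategies give formulas -/

/-- The formula `φ` of the fragment, with no free variable but `x`, is true in `u` at `i` and false
in `v` at `j`. -/
def Separates (s : Quant) (m n : ℕ) (x : Fin 2) (u : List A) (i : ℕ) (v : List A) (j : ℕ)
    (φ : Formula A) : Prop :=
  Frag s m n φ ∧ φ.freeVars ⊆ {x} ∧
    (∀ σ : Fin 2 → ℕ, σ x = i → φ.Holds u σ) ∧ ∀ τ : Fin 2 → ℕ, τ x = j → ¬ φ.Holds v τ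

theorem Separates.neg {s : Quant} {m n : ℕ} {x : Fin 2} {u v : List A} {i j : ℕ} {φ : Formula A}
    (h : Separates s m n x u i v j φ) : Separates s.dual m n x v j u i φ.neg :=
  ⟨h.1.neg, by rw [freeVars_neg]; exact h.2.1, fun σ hσ => (holds_neg _ _ _).2 (h.2.2.2 σ hσ),
    fun τ hτ h' => (holds_neg _ _ _).1 h' (h.2.2.1 τ hτ)⟩

theorem frag_of_labels_eq {s : Quant} {m n : ℕ} (hm : 1 ≤ m) {φ : Formula A}
    (h : φ.labels = [[]]) : Frag s m n φ := by
  intro l hl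
  rw [h, List.mem_singleton] at hl
  subst hl
  exact ⟨Nat.zero_le _, hm⟩

/-- The conjunction runs over the positions of `v` only, so it is finite whatever the alphabet. -/
theorem exists_separates_all {s : Quant} {m n : ℕ} (hm : 1 ≤ m) {y : Fin 2} {u v : List A} {i : ℕ}
    {S : ℕ → Prop} (N : ℕ)
    (h : ∀ j ∈ Set.Icc 1 N, S j → ∃ φ, Separates s m n y u i v j φ) :
    ∃ φ, Frag s m n φ ∧ φ.freeVars ⊆ {y} ∧ (∀ σ : Fin 2 → ℕ, σ y = i → φ.Holds u σ) ∧
      ∀ j ∈ Set.Icc 1 N, S j → ∀ τ : Fin 2 → ℕ, τ y = j → ¬ φ.Holds v τ := by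
  induction N with
  | zero =>
    refine ⟨.atom (.eq y y), frag_of_labels_eq hm rfl, by simp [Formula.freeVars, Atom.vars],
      fun _ _ => rfl, fun j hj => ?_⟩
    simp only [Set.mem_Icc] at hj
    omega
  | succ N ih =>
    obtain ⟨φ, h₁, h₂, h₃, h₄⟩ := ih fun j hj => h j ⟨hj.1, hj.2.trans (by omega)⟩
    by_cases hS : S (N + 1)
    · obtain ⟨ψ, g₁, g₂, g₃, g₄⟩ := h (N + 1) ⟨by omega, le_rfl⟩ hS
      refine ⟨.and φ ψ, frag_and.2 ⟨h₁, g₁⟩, Set.union_subset h₂ g₂,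
        fun σ hσ => ⟨h₃ σ hσ, g₃ σ hσ⟩, fun j hj hSj τ hτ hH => ?_⟩
      rcases Nat.lt_or_ge N j with hlt | hle
      · obtain rfl : j = N + 1 := le_antisymm hj.2 hlt
        exact g₄ τ hτ hH.2
      · exact h₄ j ⟨hj.1, hle⟩ hSj τ hτ hH.1
    · refine ⟨φ, h₁, h₂, h₃, fun j hj hSj => ?_⟩
      rcases Nat.lt_or_ge N j with hlt | hle
      · obtain rfl : j = N + 1 := le_antisymm hj.2 hlt
        exact absurd hSj hS
      · exact h₄ j ⟨hj.1, hle⟩ hSj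

theorem exists_guard (u v : List A) (i i' j : ℕ) {x y : Fin 2} :
    ∃ γ : Formula A, γ.labels = [[]] ∧ γ.freeVars ⊆ {x, y} ∧
      (∀ σ : Fin 2 → ℕ, σ x = i → σ y = i' → γ.Holds u σ) ∧
      ∀ τ : Fin 2 → ℕ, τ x = j → γ.Holds v τ → SameSide i i' j (τ y) := by
  rcases lt_trichotomy i i' with h | h | h
  · refine ⟨.atom (.lt x y), rfl, subset_rfl, fun σ h₁ h₂ => ?_, fun τ h₁ h₂ => ?_⟩ <;>
      simp only [Formula.Holds, Atom.Holds, SameSide] at * <;> omega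
  · refine ⟨.atom (.eq x y), rfl, subset_rfl, fun σ h₁ h₂ => ?_, fun τ h₁ h₂ => ?_⟩ <;>
      simp only [Formula.Holds, Atom.Holds, SameSide] at * <;> omega
  · refine ⟨.atom (.lt y x), rfl, (Set.pair_comm y x).subset, fun σ h₁ h₂ => ?_,
      fun τ h₁ h₂ => ?_⟩ <;>
      simp only [Formula.Holds, Atom.Holds, SameSide] at * <;> omega

theorem exists_separates_of_move {m n : ℕ} (hm : 1 ≤ m) {x y : Fin 2} (hxy : x ≠ y)
    {u v : List A} {i i' j : ℕ} (hi' : i' ∈ Set.Icc 1 u.length)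
    (h : ∀ j' ∈ Set.Icc 1 v.length, SameSide i i' j j' → ∃ φ, Separates .ex m n y u i' v j' φ) :
    ∃ φ, Separates .ex m (n + 1) x u i v j φ := by
  obtain ⟨φ, h₁, h₂, h₃, h₄⟩ := exists_separates_all hm _ h
  obtain ⟨γ, g₁, g₂, g₃, g₄⟩ := exists_guard u v i i' j (x := x) (y := y)
  refine ⟨.ex y (.and γ φ), frag_ex.2 (frag_and.2 ⟨frag_of_labels_eq hm g₁, h₁⟩), ?_, ?_, ?_⟩
  · rintro z ⟨hz | hz, hzy⟩
    · exact (g₂ hz).resolve_right hzy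
    · exact absurd (h₂ hz) hzy
  · intro σ hσ
    exact ⟨i', hi', g₃ _ (by simpa [Function.update_of_ne hxy] using hσ) (by simp),
      h₃ _ (by simp)⟩
  · rintro τ hτ ⟨j', hj', hγ, hφ⟩
    have := g₄ _ (by simpa [Function.update_of_ne hxy] using hτ) hγ
    simp only [Function.update_self] at this
    exact h₄ j' hj' this _ (by simp) hφ

theorem exists_separates_of_not_sim {m n : ℕ} (hm : 1 ≤ m) (x : Fin 2) {u v : List A} {i j : ℕ}
    (h : ¬ Sim m n u i v j) : ∃ φ, Separates .ex m n x u i v j φ := by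
  have letters : ∀ {m n : ℕ} {x : Fin 2} {u v : List A} {i j : ℕ}, 1 ≤ m →
      ¬ SameLetters u i v j → ∃ φ, Separates .ex m n x u i v j φ := by
    intro m n x u v i j hm h
    simp only [SameLetters, not_forall] at h
    obtain ⟨a, ha⟩ := h
    by_cases hu : HasLetter u i a
    · refine ⟨.atom (.letter a x), frag_of_labels_eq hm rfl, subset_rfl, ?_, ?_⟩
      · rintro σ rfl; exact hu
      · rintro τ rfl hv
        exact ha (iff_of_true hu hv)
    · refine ⟨.natom (.letter a x), frag_of_labels_eq hm rfl, subset_rfl, ?_, ?_⟩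
      · rintro σ rfl; exact hu
      · rintro τ rfl hv
        exact ha (iff_of_false hu hv)
  induction n generalizing m x u v i j with
  | zero => exact letters hm h
  | succ n ih =>
    have hxy : x ≠ 1 - x := by fin_cases x <;> simp
    by_cases hl : SameLetters u i v j
    swap
    · exact letters hm hl
    simp only [Sim, hl, true_and, not_and_or] at h
    rcases h with h | h
    · push Not at h
      obtain ⟨i', hi', h⟩ := h
      exact exists_separates_of_move hm hxy hi' fun j' hj' hs => ih hm _ (h j' hj' hs)
    · push Not at h
      obtain ⟨hm', j', hj', h⟩ := h
      obtain ⟨φ, hφ⟩ := exists_separates_of_move (m := m - 1) (by omega) hxy hj'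
        fun i' hi' hs => ih (by omega) _ (h i' hi' hs)
      -- Spoiler's winning move on `v` gives an existential formula for `v` with one block fewer;
      -- its negation is universal, and placing it below `∃` uses up the block.
      refine ⟨φ.neg, ?_, hφ.neg.2⟩
      have := hφ.neg.1.switch .ex
      rwa [Nat.sub_add_cancel hm] at this

theorem exists_sentence_of_move {m n : ℕ} (hm : 1 ≤ m) {u v : List A} {i : ℕ}
    (hi : i ∈ Set.Icc 1 u.length) (h : ∀ j ∈ Set.Icc 1 v.length, ¬ Sim m n u i v j) :
    ∃ φ ∈ FO2 A m (n + 1), Satisfies u φ ∧ ¬ Satisfies v φ := by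
  obtain ⟨φ, h₁, h₂, h₃, h₄⟩ := exists_separates_all (s := .ex) (n := n) (u := u) (v := v) (i := i)
    (y := 0) (S := fun _ => True) hm v.length
    fun j hj _ => exists_separates_of_not_sim hm 0 (h j hj)
  refine ⟨.ex 0 φ, ⟨Set.sdiff_eq_empty.2 h₂, fun l hl => ?_⟩, ⟨i, hi, h₃ _ (by simp)⟩, ?_⟩
  · have := frag_ex.2 h₁ l hl
    exact ⟨this.1, (blockCount_le_cons _ _).trans this.2⟩
  · rintro ⟨j, hj, hφ⟩
    exact h₄ j hj trivial _ (by simp) hφ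

theorem FO2_mono {m m' n : ℕ} (h : m ≤ m') : FO2 A m n ⊆ FO2 A m' n :=
  fun _ hφ => ⟨hφ.1, fun l hl => ⟨(hφ.2 l hl).1, (hφ.2 l hl).2.trans h⟩⟩

theorem sim_zero_of_equiv {m n : ℕ} (hm : 1 ≤ m) {u v : List A}
    (h : ∀ φ ∈ FO2 A m n, Satisfies u φ ↔ Satisfies v φ) : Sim m n u 0 v 0 := by
  have letters : SameLetters u 0 v 0 := fun a => by simp [HasLetter]
  cases n with
  | zero => exact letters
  | succ n =>
    have side : ∀ {i j : ℕ}, 1 ≤ i → 1 ≤ j → SameSide 0 i 0 j := by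
      intro i j hi hj; unfold SameSide; omega
    refine ⟨letters, fun i hi => ?_, fun hm' j hj => ?_⟩
    · by_contra hc
      obtain ⟨φ, hφ, hu, hv⟩ := exists_sentence_of_move (n := n) hm hi
        fun j hj hsim => hc ⟨j, hj, side hi.1 hj.1, hsim⟩
      exact hv ((h φ hφ).1 hu)
    · by_contra hc
      obtain ⟨φ, hφ, hv, hu⟩ := exists_sentence_of_move (n := n) (m := m - 1) (by omega) hj
        fun i hi hsim => hc ⟨i, hi, side hj.1 hi.1, hsim⟩
      exact hu ((h φ (FO2_mono (by omega) hφ)).2 hv)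

/-- Two words satisfy the same sentences if and only if Duplicator wins the game, whichever word
Spoiler starts on. -/
theorem equiv_iff_sim {m n : ℕ} (hm : 1 ≤ m) {u v : List A} :
    (∀ φ ∈ FO2 A m n, Satisfies u φ ↔ Satisfies v φ) ↔ Sim m n u 0 v 0 ∧ Sim m n v 0 u 0 :=
  ⟨fun h => ⟨sim_zero_of_equiv hm h, sim_zero_of_equiv hm fun φ hφ => (h φ hφ).symm⟩,
    fun h _ hφ => ⟨holds_of_sim_zero h.1 h.2 hφ.2, holds_of_sim_zero h.2 h.1 hφ.2⟩⟩

/-! ### Directions -/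

/-- The opposite direction. -/
def Dir.op : Dir → Dir
  | .X => .Y
  | .Y => .X

/-- `d.lt x y`: the position `x` comes strictly before `y` when one reads in direction `d`. -/
def Dir.lt : Dir → ℕ → ℕ → Prop
  | .X, x, y => x < y
  | .Y, x, y => y < x

/-- The position outside of the word `u` from which one starts to read in direction `d`. -/
def startPos (u : List A) : Dir → ℕ
  | .X => 0
  | .Y => u.length + 1

theorem Dir.eq_op_of_ne {d e : Dir} (h : e ≠ d) : e = d.op := by
  cases d <;> cases e <;> simp_all [Dir.op]

theorem Dir.lt_op {d : Dir} {x y : ℕ} : d.op.lt x y ↔ d.lt y x := by cases d <;> rfl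

theorem Dir.lt_of_le_of_lt {d : Dir} {x y z : ℕ} (h₁ : ¬ d.lt y x) (h₂ : d.lt y z) :
    d.lt x z := by
  cases d <;> simp only [Dir.lt] at * <;> omega

theorem Dir.le_trans {d : Dir} {x y z : ℕ} (h₁ : ¬ d.lt y x) (h₂ : ¬ d.lt z y) : ¬ d.lt z x := by
  cases d <;> simp only [Dir.lt] at * <;> omega

theorem Dir.lt_or_eq_or_gt (d : Dir) (x y : ℕ) : d.lt x y ∨ x = y ∨ d.lt y x := by
  cases d <;> simp only [Dir.lt] at * <;> omega

theorem Dir.not_lt_of_lt {d : Dir} {x y : ℕ} (h : d.lt x y) : ¬ d.lt y x := by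
  cases d <;> simp only [Dir.lt] at * <;> omega

theorem sameSide_iff_of_lt (d : Dir) {i i' j j' : ℕ} :
    SameSide i i' j j' ↔ (d.lt i i' ↔ d.lt j j') ∧ (d.lt i' i ↔ d.lt j' j) := by
  cases d
  · exact Iff.rfl
  · exact and_comm

theorem sameSide_of_lt {d : Dir} {i i' j j' : ℕ} (h : d.lt i i') (h' : d.lt j j') :
    SameSide i i' j j' :=
  (sameSide_iff_of_lt d).2 ⟨iff_of_true h h', iff_of_false (d.not_lt_of_lt h) (d.not_lt_of_lt h')⟩

/-! ### Letters at positions and next occurrences -/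

theorem HasLetter.mem_Icc {u : List A} {i : ℕ} {a : A} (h : HasLetter u i a) :
    i ∈ Set.Icc 1 u.length := by
  obtain ⟨h₁, h₂⟩ := h
  obtain ⟨h₃, -⟩ := List.getElem?_eq_some_iff.1 h₂
  exact ⟨h₁, by omega⟩

theorem exists_hasLetter {u : List A} {i : ℕ} (h : i ∈ Set.Icc 1 u.length) :
    ∃ a, HasLetter u i a :=
  ⟨u[i - 1]'(by have := h.1; have := h.2; omega), h.1, List.getElem?_eq_getElem _⟩

theorem HasLetter.unique {u : List A} {i : ℕ} {a b : A} (h : HasLetter u i a)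
    (h' : HasLetter u i b) : a = b :=
  Option.some_injective _ (h.2.symm.trans h'.2)

theorem sameLetters_of_hasLetter {u v : List A} {i j : ℕ} {a : A} (h : HasLetter u i a)
    (h' : HasLetter v j a) : SameLetters u i v j := fun _ =>
  ⟨fun hb => h.unique hb ▸ h', fun hb => h'.unique hb ▸ h⟩

theorem startPos_lt {u : List A} {i : ℕ} (h : i ∈ Set.Icc 1 u.length) (d : Dir) :
    d.lt (startPos u d) i := by
  obtain ⟨h₁, h₂⟩ := h
  cases d <;> simp only [Dir.lt, startPos] <;> omega

theorem lt_startPos_op {u : List A} {i : ℕ} (h : i ∈ Set.Icc 1 u.length) (d : Dir) :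
    d.lt i (startPos u d.op) :=
  Dir.lt_op.1 (startPos_lt h d.op)

theorem next_iff {u : List A} {z : Dir × A} {q p : ℕ} :
    Next u z q p ↔ z.1.lt q p ∧ HasLetter u p z.2 ∧
      ∀ p', z.1.lt q p' → HasLetter u p' z.2 → ¬ z.1.lt p' p := by
  obtain ⟨_ | _, a⟩ := z <;>
    simp [Next, IsLeast, IsGreatest, lowerBounds, upperBounds, Dir.lt, and_assoc]

theorem Next.lt {u : List A} {z : Dir × A} {q p : ℕ} (h : Next u z q p) : z.1.lt q p :=
  (next_iff.1 h).1

theorem Next.hasLetter {u : List A} {z : Dir × A} {q p : ℕ} (h : Next u z q p) :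
    HasLetter u p z.2 :=
  (next_iff.1 h).2.1

theorem Next.not_lt {u : List A} {z : Dir × A} {q p p' : ℕ} (h : Next u z q p)
    (h₁ : z.1.lt q p') (h₂ : HasLetter u p' z.2) : ¬ z.1.lt p' p :=
  (next_iff.1 h).2.2 p' h₁ h₂

theorem Next.unique {u : List A} {z : Dir × A} {q p p' : ℕ} (h : Next u z q p)
    (h' : Next u z q p') : p = p' := by
  obtain ⟨_ | _, a⟩ := z
  · exact IsLeast.unique h h'
  · exact IsGreatest.unique h h'

theorem exists_next {u : List A} {z : Dir × A} {q p' : ℕ} (h : z.1.lt q p')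
    (h' : HasLetter u p' z.2) : ∃ p, Next u z q p := by
  obtain ⟨_ | _, a⟩ := z
  · exact ⟨_, isLeast_csInf (s := {i | q < i ∧ HasLetter u i a}) ⟨p', h, h'⟩⟩
  · exact ⟨_, Nat.sSup_mem (s := {i | i < q ∧ HasLetter u i a}) ⟨p', h, h'⟩
      ⟨q, fun i hi => hi.1.le⟩, fun i hi => le_csSup ⟨q, fun i hi => hi.1.le⟩ hi⟩

/-! ### Rankers, read backwards

From here on the last letter of a ranker stands at the head of the list. -/

/-- Positions reached by rankers. For the empty ranker this is the starting position of
direction `d`. -/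
def At (u : List A) : RankerWord A → Dir → ℕ → Prop
  | [], d, p => p = startPos u d
  | z :: s, _, p => ∃ q, At u s z.1 q ∧ Next u z q p

/-- The number of blocks of a ranker. -/
def blocks (s : RankerWord A) : ℕ := blockCount (s.map Prod.fst)

/-- The number of blocks of a ranker that is prolonged by a letter of direction `d`. -/
def nextBlocks (d : Dir) (s : RankerWord A) : ℕ := blockCount (d :: s.map Prod.fst)

theorem blocks_cons (z : Dir × A) (s : RankerWord A) : blocks (z :: s) = nextBlocks z.1 s := rfl

theorem nextBlocks_cons_of_eq {d : Dir} {z : Dir × A} (h : z.1 = d) (s : RankerWord A) :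
    nextBlocks d (z :: s) = nextBlocks d s := by
  subst h; exact blockCount_cons_self _ _

theorem nextBlocks_cons_of_ne {d : Dir} {z : Dir × A} (h : z.1 ≠ d) (s : RankerWord A) :
    nextBlocks d (z :: s) = blocks (z :: s) + 1 :=
  blockCount_cons_of_ne h.symm _

theorem blocks_le_nextBlocks (d : Dir) (s : RankerWord A) : blocks s ≤ nextBlocks d s :=
  blockCount_le_cons _ _

theorem nextBlocks_le (d : Dir) (s : RankerWord A) : nextBlocks d s ≤ blocks s + 1 :=
  blockCount_cons_le _ _

theorem one_le_nextBlocks (d : Dir) (s : RankerWord A) : 1 ≤ nextBlocks d s :=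
  blockCount_cons_pos _ _

theorem At.unique {u : List A} {s : RankerWord A} {d : Dir} {p p' : ℕ} (h : At u s d p)
    (h' : At u s d p') : p = p' := by
  induction s generalizing d p p' with
  | nil => exact h.trans h'.symm
  | cons z s ih =>
    obtain ⟨q, hq, hn⟩ := h
    obtain ⟨q', hq', hn'⟩ := h'
    obtain rfl := ih hq hq'
    exact hn.unique hn'

theorem At.mem_Icc {u : List A} {z : Dir × A} {s : RankerWord A} {d : Dir} {p : ℕ}
    (h : At u (z :: s) d p) : p ∈ Set.Icc 1 u.length := by
  obtain ⟨q, -, hn⟩ := h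
  exact hn.hasLetter.mem_Icc

/-! ### Condensed rankers and their intervals -/

/-- The boundary of an interval from which one starts to read in direction `d`. -/
def near : Dir → ℕ × ℕ → ℕ
  | .X, I => I.1
  | .Y, I => I.2

/-- The interval that is left of `I` when one is at `p` and goes on in direction `d`. -/
def cut : Dir → ℕ → ℕ × ℕ → ℕ × ℕ
  | .X, p, I => (p, I.2)
  | .Y, p, I => (I.1, p)

theorem near_cut (d : Dir) (p : ℕ) (I : ℕ × ℕ) : near d (cut d p I) = p := by cases d <;> rfl

theorem near_op_cut (d : Dir) (p : ℕ) (I : ℕ × ℕ) : near d.op (cut d p I) = near d.op I := by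
  cases d <;> rfl

theorem mem_Ioo_iff_near (d : Dir) {p : ℕ} {I : ℕ × ℕ} :
    p ∈ Set.Ioo I.1 I.2 ↔ d.lt (near d I) p ∧ d.lt p (near d.op I) := by
  cases d
  · exact Iff.rfl
  · exact and_comm

/-- `Zoom u s d I`: the ranker `s`, followed by a letter of direction `d`, is executed on `u`
without leaving any of its intervals, and `I` is the interval then reached. -/
def Zoom (u : List A) : RankerWord A → Dir → ℕ × ℕ → Prop
  | [], _, I => I = (0, u.length + 1)
  | z :: s, d, I => ∃ J p, Zoom u s z.1 J ∧ Next u z (near z.1 J) p ∧ p ∈ Set.Ioo J.1 J.2 ∧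
      I = cut d p J

/-- `CondensedAt u s d p`: the ranker `s` is condensed on `u` and reaches `p`. For the empty ranker
this is the starting position of direction `d`. -/
def CondensedAt (u : List A) : RankerWord A → Dir → ℕ → Prop
  | [], d, p => p = startPos u d
  | z :: s, _, p => ∃ J, Zoom u s z.1 J ∧ Next u z (near z.1 J) p ∧ p ∈ Set.Ioo J.1 J.2

theorem near_univ (u : List A) (d : Dir) : near d (0, u.length + 1) = startPos u d := by
  cases d <;> rfl

theorem Zoom.unique {u : List A} {s : RankerWord A} {d : Dir} {I I' : ℕ × ℕ} (h : Zoom u s d I)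
    (h' : Zoom u s d I') : I = I' := by
  induction s generalizing d I I' with
  | nil => exact Eq.trans h (Eq.symm h')
  | cons z s ih =>
    obtain ⟨J, p, hJ, hn, -, rfl⟩ := h
    obtain ⟨J', p', hJ', hn', -, rfl⟩ := h'
    obtain rfl := ih hJ hJ'
    rw [hn.unique hn']

theorem Zoom.condensedAt_near {u : List A} {s : RankerWord A} {d : Dir} {I : ℕ × ℕ}
    (h : Zoom u s d I) : CondensedAt u s d (near d I) := by
  cases s with
  | nil => cases h; exact near_univ u d
  | cons z s =>
    obtain ⟨J, p, hJ, hn, hp, rfl⟩ := h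
    rw [near_cut]
    exact ⟨J, hJ, hn, hp⟩

theorem Zoom.at_near {u : List A} {s : RankerWord A} {d : Dir} {I : ℕ × ℕ}
    (h : Zoom u s d I) : At u s d (near d I) := by
  induction s generalizing d I with
  | nil => cases h; exact near_univ u d
  | cons z s ih =>
    obtain ⟨J, p, hJ, hn, hp, rfl⟩ := h
    rw [near_cut]
    exact ⟨_, ih hJ, hn⟩

theorem CondensedAt.at {u : List A} {s : RankerWord A} {d : Dir} {p : ℕ}
    (h : CondensedAt u s d p) : At u s d p := by
  cases s with
  | nil => exact h
  | cons z s =>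
    obtain ⟨J, hJ, hn, -⟩ := h
    exact ⟨_, hJ.at_near, hn⟩

theorem CondensedAt.zoom {u : List A} {z : Dir × A} {s : RankerWord A} {d : Dir} {p : ℕ}
    (h : CondensedAt u (z :: s) d p) (e : Dir) : ∃ I, Zoom u (z :: s) e I ∧ near e I = p := by
  obtain ⟨J, hJ, hn, hp⟩ := h
  exact ⟨cut e p J, ⟨J, p, hJ, hn, hp, rfl⟩, near_cut _ _ _⟩

/-- The prefix of the ranker `s` (read backwards) which reaches the far boundary of the interval
of `s` followed by a letter of direction `d`. -/
def farPrefix : RankerWord A → Dir → RankerWord A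
  | [], _ => []
  | z :: s, d => if z.1 = d then farPrefix s d else s

/-- Going on in direction `d` leaves the far boundary alone. At a turn, the letter just read becomes
the near boundary and the far one is the position from which that letter was read. -/
theorem Zoom.condensedAt_far {u : List A} {s : RankerWord A} {d : Dir} {I : ℕ × ℕ}
    (h : Zoom u s d I) : CondensedAt u (farPrefix s d) d.op (near d.op I) := by
  induction s generalizing d I with
  | nil => cases h; exact near_univ u d.op
  | cons z s ih =>
    obtain ⟨J, p, hJ, hn, hp, rfl⟩ := h
    rw [near_op_cut]
    by_cases hz : z.1 = d
    · subst hz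
      simpa [farPrefix] using ih hJ
    · rw [farPrefix, if_neg hz, ← Dir.eq_op_of_ne hz]
      exact hJ.condensedAt_near

theorem length_farPrefix_le (s : RankerWord A) (d : Dir) : (farPrefix s d).length ≤ s.length := by
  induction s with
  | nil => rfl
  | cons z s ih =>
    simp only [farPrefix, List.length_cons]
    split <;> omega

/-- The prefix ends before the last turn into direction `d`, hence the strict drop. This places far
boundaries among the rankers with at most `m - 1` blocks. -/
theorem blocks_farPrefix_lt (s : RankerWord A) (d : Dir) :
    blocks (farPrefix s d) < nextBlocks d s := by
  induction s with
  | nil => exact Nat.one_pos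
  | cons z s ih =>
    by_cases hz : z.1 = d
    · rwa [farPrefix, if_pos hz, nextBlocks_cons_of_eq hz]
    · rw [farPrefix, if_neg hz, nextBlocks_cons_of_ne hz, blocks_cons]
      exact Nat.lt_succ_of_le (blocks_le_nextBlocks _ _)

/-! ### Duplicator's strategies preserve condensed rankers -/

/-- If Duplicator wins, then he preserves on which side of the pebble the value of a ranker is. -/
def PreservesSides (A : Type*) (n : ℕ) : Prop :=
  ∀ (m : ℕ) (u v : List A) (i j : ℕ) (z : Dir × A) (s : RankerWord A) (d : Dir) (p q : ℕ),
    Sim m n u i v j → nextBlocks z.1 s ≤ m → s.length < n → At u (z :: s) d p →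
    At v (z :: s) d q → (z.1.lt p i → z.1.lt q j) ∧ (¬ z.1.lt i p → ¬ z.1.lt j q)

/-- Spoiler moves to `p`. As the ranker without its last letter is before `p` in `u`, the induction
hypothesis puts it before the reply in `v`. -/
theorem PreservesSides.reply {n : ℕ} (hn : PreservesSides A n) {m : ℕ} {u v : List A} {i j : ℕ}
    (h : Sim m (n + 1) u i v j) {z : Dir × A} {s : RankerWord A} {d : Dir} {p qs : ℕ}
    (hb : nextBlocks z.1 s ≤ m) (hl : s.length ≤ n) (hu : At u (z :: s) d p)
    (hv : At v s z.1 qs) :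
    ∃ j' ∈ Set.Icc 1 v.length, SameSide i p j j' ∧ Sim m n u p v j' ∧ HasLetter v j' z.2 ∧
      z.1.lt qs j' := by
  obtain ⟨j', hj', hs, hsim⟩ := h.2.1 p hu.mem_Icc
  obtain ⟨ps, hps, hnx⟩ := hu
  refine ⟨j', hj', hs, hsim, (hsim.sameLetters _).1 hnx.hasLetter, ?_⟩
  rcases s with _ | ⟨y, s⟩
  · cases hv
    exact startPos_lt hj' _
  · by_cases hy : y.1 = z.1
    · have := (hn m u v p j' y s z.1 ps qs hsim
        (by rwa [nextBlocks_cons_of_eq hy, ← hy] at hb) hl hps hv).1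
      rw [hy] at this
      exact this hnx.lt
    -- A turn leaves a spare block, which pays for exchanging the words; the second half of
    -- `PreservesSides` is then used in contraposition.
    · rw [nextBlocks_cons_of_ne hy, blocks_cons] at hb
      have := one_le_nextBlocks y.1 s
      have := (hn (m - 1) v u j' p y s z.1 qs ps (hsim.switch (by omega)) (by omega) hl hv hps).2
      rw [Dir.eq_op_of_ne hy, Dir.lt_op, Dir.lt_op] at this
      exact not_imp_not.1 this hnx.lt

theorem preservesSides (n : ℕ) : PreservesSides A n := by
  induction n with
  | zero => intro m u v i j z s d p q _ _ hl; omega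
  | succ n ih =>
    intro m u v i j z s d p q hsim hb hl hu hv
    obtain ⟨qs, hqs, hnx⟩ := hv
    obtain ⟨j', -, hs, -, hlet, hlt⟩ := ih.reply hsim hb (by omega) hu hqs
    have hq := hnx.not_lt hlt hlet
    rw [sameSide_iff_of_lt z.1] at hs
    exact ⟨fun h => Dir.lt_of_le_of_lt hq (hs.2.1 h), fun h => Dir.le_trans hq (mt hs.1.2 h)⟩

theorem exists_at_of_sim {m n : ℕ} {u v : List A} (h : Sim m n u 0 v 0) {s : RankerWord A}
    {d : Dir} {p : ℕ} (hb : blocks s ≤ m) (hl : s.length ≤ n) (hu : At u s d p) :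
    ∃ q, At v s d q := by
  induction s generalizing d p with
  | nil => exact ⟨_, rfl⟩
  | cons z s ih =>
    obtain ⟨ps, hps, hnx⟩ := id hu
    obtain ⟨qs, hqs⟩ := ih ((blocks_le_nextBlocks _ _).trans hb) (by simp at hl; omega) hps
    obtain _ | n := n
    · simp at hl
    obtain ⟨j', -, -, -, hlet, hlt⟩ :=
      (preservesSides n).reply h hb (by simpa using hl) hu hqs
    obtain ⟨q, hq⟩ := exists_next hlt hlet
    exact ⟨q, qs, hqs, hq⟩

/-- After Spoiler's move to `p`, the value `q` is weakly before the reply, so it remains to compare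
the reply with `q'`. Equal end directions require exchanging the words, hence one block fewer for `y
:: t`; different ones do not. This is the source of the two order conditions. -/
theorem lt_and_le_of_sim {m n : ℕ} {u v : List A} (h : Sim m n u 0 v 0) {z y : Dir × A}
    {s t : RankerWord A} {d e : Dir} {p q p' q' : ℕ}
    (hb : nextBlocks z.1 s ≤ m) (hl : s.length < n)
    (hb' : nextBlocks y.1 t < m ∨ nextBlocks y.1 t ≤ m ∧ y.1 ≠ z.1) (hl' : t.length + 1 < n)
    (hu : At u (z :: s) d p) (hv : At v (z :: s) d q)
    (hu' : At u (y :: t) e p') (hv' : At v (y :: t) e q') :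
    (z.1.lt p p' → z.1.lt q q') ∧ (¬ z.1.lt p' p → ¬ z.1.lt q' q) := by
  obtain ⟨n, rfl⟩ : ∃ k, n = k + 1 := ⟨n - 1, by omega⟩
  obtain ⟨qs, hqs, hnx⟩ := hv
  obtain ⟨j', -, -, hsim, hlet, hlt⟩ := (preservesSides n).reply h hb (by omega) hu hqs
  have hq := hnx.not_lt hlt hlet
  by_cases hyz : y.1 = z.1
  · have hb'' : nextBlocks y.1 t < m := hb'.elim id fun h => absurd hyz h.2
    have := one_le_nextBlocks y.1 t
    have key := preservesSides n (m - 1) v u j' p y t e q' p' (hsim.switch (by omega))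
      (by omega) (by omega) hv' hu'
    rw [hyz] at key
    exact ⟨fun hp => Dir.lt_of_le_of_lt hq (not_imp_not.1 key.2 hp),
      fun hp => Dir.le_trans hq (mt key.1 hp)⟩
  · have key := preservesSides n m u v p j' y t e p' q' hsim (by omega) (by omega) hu' hv'
    rw [Dir.eq_op_of_ne hyz, Dir.lt_op, Dir.lt_op, Dir.lt_op, Dir.lt_op] at key
    exact ⟨fun hp => Dir.lt_of_le_of_lt hq (key.1 hp), fun hp => Dir.le_trans hq (key.2 hp)⟩

theorem sameSide_of_sim {m n : ℕ} {u v : List A} (h : Sim m n u 0 v 0) (h' : Sim m n v 0 u 0)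
    {z y : Dir × A} {s t : RankerWord A} {d e : Dir} {p q p' q' : ℕ}
    (hb : nextBlocks z.1 s ≤ m) (hl : s.length < n)
    (hb' : nextBlocks y.1 t < m ∨ nextBlocks y.1 t ≤ m ∧ y.1 ≠ z.1) (hl' : t.length + 1 < n)
    (hu : At u (z :: s) d p) (hv : At v (z :: s) d q)
    (hu' : At u (y :: t) e p') (hv' : At v (y :: t) e q') : SameSide p p' q q' := by
  have h₁ := lt_and_le_of_sim h hb hl hb' hl' hu hv hu' hv'
  have h₂ := lt_and_le_of_sim h' hb hl hb' hl' hv hu hv' hu'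
  rw [sameSide_iff_of_lt z.1]
  exact ⟨⟨h₁.1, h₂.1⟩, not_iff_not.1 ⟨h₁.2, h₂.2⟩⟩

theorem exists_zoom_of_sim {m n : ℕ} {u v : List A} (h : Sim m n u 0 v 0) {s : RankerWord A}
    {d : Dir} {I : ℕ × ℕ} (hb : nextBlocks d s ≤ m) (hl : s.length ≤ n) (hu : Zoom u s d I) :
    ∃ J, Zoom v s d J := by
  induction s generalizing d I with
  | nil => exact ⟨_, rfl⟩
  | cons z s ih =>
    obtain ⟨I, p, hI, hnx, hp, rfl⟩ := hu
    have hb₁ : nextBlocks z.1 s ≤ m := (blocks_le_nextBlocks d (z :: s)).trans hb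
    obtain ⟨J, hJ⟩ := ih hb₁ (by simp at hl; omega) hI
    have hpu : At u (z :: s) d p := ⟨_, hI.at_near, hnx⟩
    obtain ⟨q, hq⟩ := exists_at_of_sim (s := z :: s) h hb₁ hl hpu
    obtain ⟨q₀, hq₀, hnx'⟩ := id hq
    obtain rfl := hq₀.unique hJ.at_near
    refine ⟨cut d q J, J, q, hJ, hnx', (mem_Ioo_iff_near z.1).2 ⟨hnx'.lt, ?_⟩, rfl⟩
    -- Staying inside the interval means that `q` is before its far boundary, which is a comparison
    -- with a ranker having fewer blocks or with the outside of the word.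
    have hfu := hI.condensedAt_far.at
    have hfv := hJ.condensedAt_far.at
    have hfb := blocks_farPrefix_lt s z.1
    have hfl := length_farPrefix_le s z.1
    rcases hw : farPrefix s z.1 with _ | ⟨y, t⟩
    · rw [hw] at hfv
      rw [show near z.1.op J = _ from hfv]
      exact lt_startPos_op hq.mem_Icc _
    · rw [hw] at hfu hfv hfb hfl
      rw [blocks_cons] at hfb
      simp only [List.length_cons] at hfl hl
      exact (lt_and_le_of_sim h hb₁ (by omega) (.inl (by omega)) (by omega) hpu hq hfu hfv).1
        ((mem_Ioo_iff_near z.1).1 hp).2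

theorem exists_condensedAt_of_sim {m n : ℕ} {u v : List A} (h : Sim m n u 0 v 0)
    {s : RankerWord A} {d : Dir} {p : ℕ} (hb : blocks s ≤ m) (hl : s.length ≤ n)
    (hu : CondensedAt u s d p) : ∃ q, CondensedAt v s d q := by
  cases s with
  | nil => exact ⟨_, rfl⟩
  | cons z s =>
    obtain ⟨I, hI, -⟩ := hu.zoom z.1
    obtain ⟨J, hJ⟩ := exists_zoom_of_sim h (by rwa [nextBlocks_cons_of_eq rfl]) hl hI
    exact ⟨_, hJ.condensedAt_near⟩

/-! ### Condensed rankers give strategies for Duplicator -/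

theorem CondensedAt.unique {u : List A} {s : RankerWord A} {d : Dir} {p p' : ℕ}
    (h : CondensedAt u s d p) (h' : CondensedAt u s d p') : p = p' :=
  h.at.unique h'.at

theorem CondensedAt.hasLetter {u : List A} {z : Dir × A} {s : RankerWord A} {d : Dir} {p : ℕ}
    (h : CondensedAt u (z :: s) d p) : HasLetter u p z.2 := by
  obtain ⟨J, -, hn, -⟩ := h
  exact hn.hasLetter

/-- The nonempty ranker `z :: s` (read backwards) has at most `m` blocks and depth at most `n`. -/
def InRk (m n : ℕ) (z : Dir × A) (s : RankerWord A) : Prop :=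
  nextBlocks z.1 s ≤ m ∧ s.length < n

theorem InRk.mono {m m' n n' : ℕ} {z : Dir × A} {s : RankerWord A} (h : InRk m n z s)
    (hm : m ≤ m') (hn : n ≤ n') : InRk m' n' z s :=
  ⟨h.1.trans hm, h.2.trans_le hn⟩

/-- `u` and `v` agree on condensed rankers with at most `m` blocks and depth at most `n`, and on the
order of their values. -/
structure Agree (m n : ℕ) (u v : List A) : Prop where
  condensed : ∀ (z : Dir × A) (s : RankerWord A), InRk m n z s →
    ((∃ p, CondensedAt u (z :: s) z.1 p) ↔ ∃ q, CondensedAt v (z :: s) z.1 q)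
  order : ∀ (z y : Dir × A) (s t : RankerWord A) (p q p' q' : ℕ), InRk m n z s →
    (InRk (m - 1) (n - 1) y t ∨ InRk m (n - 1) y t ∧ y.1 ≠ z.1) →
    CondensedAt u (z :: s) z.1 p → CondensedAt v (z :: s) z.1 q →
    CondensedAt u (y :: t) y.1 p' → CondensedAt v (y :: t) y.1 q' → SameSide p p' q q'

theorem Agree.symm {m n : ℕ} {u v : List A} (h : Agree m n u v) : Agree m n v u :=
  ⟨fun z s hs => (h.condensed z s hs).symm, fun z y s t p q p' q' hs ht h₁ h₂ h₃ h₄ =>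
    (h.order z y s t q p q' p' hs ht h₂ h₁ h₄ h₃).symm⟩

theorem Agree.mono {m m' n n' : ℕ} {u v : List A} (h : Agree m n u v) (hm : m' ≤ m)
    (hn : n' ≤ n) : Agree m' n' u v :=
  ⟨fun z s hs => h.condensed z s (hs.mono hm hn), fun z y s t p q p' q' hs ht =>
    h.order z y s t p q p' q' (hs.mono hm hn)
      (ht.imp (fun h => h.mono (by omega) (by omega))
        fun h => ⟨h.1.mono (by omega) (by omega), h.2⟩)⟩

/-- What condensed rankers say about the position `i` of `u` and the position `j` of `v`. -/
structure Similar (m n : ℕ) (u : List A) (i : ℕ) (v : List A) (j : ℕ) : Prop where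
  letters : SameLetters u i v j
  sides : ∀ (z : Dir × A) (s : RankerWord A) (p q : ℕ), InRk (m - 1) n z s →
    CondensedAt u (z :: s) z.1 p → CondensedAt v (z :: s) z.1 q → SameSide i p j q
  lt : ∀ (z : Dir × A) (s : RankerWord A) (p q : ℕ), InRk m n z s →
    CondensedAt u (z :: s) z.1 p → CondensedAt v (z :: s) z.1 q → z.1.lt p i → z.1.lt q j

theorem Similar.mono {m n n' : ℕ} {u v : List A} {i j : ℕ} (h : Similar m n u i v j)
    (hn : n' ≤ n) : Similar m n' u i v j :=
  ⟨h.letters, fun z s p q hs => h.sides z s p q (hs.mono le_rfl hn),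
    fun z s p q hs => h.lt z s p q (hs.mono le_rfl hn)⟩

/-- The one-sided condition `lt` for the new game follows from `sides`, which is two-sided and
already concerns `m - 1` blocks. -/
theorem Similar.switch {m n : ℕ} {u v : List A} {i j : ℕ} (h : Similar m n u i v j) :
    Similar (m - 1) n v j u i :=
  ⟨h.letters.symm,
    fun z s p q hs hp hq => (h.sides z s q p (hs.mono (by omega) le_rfl) hq hp).symm,
    fun z s p q hs hp hq hlt =>
      ((sameSide_iff_of_lt z.1).1 (h.sides z s q p hs hq hp)).2.2 hlt⟩

theorem exists_last (d : Dir) {N : ℕ} {S : Set ℕ} (hS : S ⊆ Set.Icc 1 N) (hne : S.Nonempty) :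
    ∃ x ∈ S, ∀ y ∈ S, ¬ d.lt x y := by
  have hf : S.Finite := (Set.finite_Icc 1 N).subset hS
  cases d
  · obtain ⟨x, hx, h⟩ := Set.exists_max_image S id hf hne
    exact ⟨x, hx, fun y hy => (h y hy).not_gt⟩
  · obtain ⟨x, hx, h⟩ := Set.exists_min_image S id hf hne
    exact ⟨x, hx, fun y hy => (h y hy).not_gt⟩

/-- Unless `i` is the value of a condensed ranker with fewer blocks, there is a condensed ranker
ending with the letter of `i`, weakly before `i` in direction `d`, which in `v` comes after all
the rankers of smaller depth that are before `i` in `u`. -/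
theorem exists_condensed_approximation {m n : ℕ} (hm : 1 ≤ m) {u v : List A}
    (h : Agree m (n + 1) u v) {i : ℕ} {a : A} (ha : HasLetter u i a)
    (hi : ∀ (z : Dir × A) (s : RankerWord A), InRk (m - 1) n z s → ¬ CondensedAt u (z :: s) z.1 i)
    (d : Dir) :
    ∃ (s : RankerWord A) (p q : ℕ), InRk m (n + 1) (d, a) s ∧ CondensedAt u ((d, a) :: s) d p ∧
      CondensedAt v ((d, a) :: s) d q ∧ ¬ d.lt i p ∧
      ∀ (y : Dir × A) (t : RankerWord A) (p' q' : ℕ),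
        (InRk (m - 1) n y t ∨ InRk m n y t ∧ y.1 = d) → CondensedAt u (y :: t) y.1 p' →
        CondensedAt v (y :: t) y.1 q' → d.lt p' i → d.lt q' q := by
  set S : Set ℕ := {q' | ∃ (y : Dir × A) (t : RankerWord A) (p' : ℕ),
    (InRk (m - 1) n y t ∨ InRk m n y t ∧ y.1 = d) ∧ CondensedAt u (y :: t) y.1 p' ∧
    CondensedAt v (y :: t) y.1 q' ∧ d.lt p' i} with hS
  suffices H : ∃ (s : RankerWord A) (p q₀ : ℕ), InRk m (n + 1) (d, a) s ∧
      CondensedAt u ((d, a) :: s) d p ∧ CondensedAt v s d q₀ ∧ ¬ d.lt i p ∧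
      ∀ q' ∈ S, ¬ d.lt q₀ q' by
    obtain ⟨s, p, q₀, hs, hp, hq₀, hip, hmax⟩ := H
    obtain ⟨q, hq⟩ := (h.condensed (d, a) s hs).1 ⟨p, hp⟩
    refine ⟨s, p, q, hs, hp, hq, hip, fun y t p' q' ht hp' hq' hlt => ?_⟩
    refine Dir.lt_of_le_of_lt (hmax q' ⟨y, t, p', ht, hp', hq', hlt⟩) ?_
    obtain ⟨J, hJ, hn, -⟩ := hq
    obtain rfl := hq₀.unique hJ.condensedAt_near
    exact hn.lt
  rcases S.eq_empty_or_nonempty with hE | hne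
  -- With no ranker to go beyond, the one-letter ranker is taken.
  · have hlt := startPos_lt ha.mem_Icc d
    obtain ⟨p, hp⟩ := exists_next (z := (d, a)) hlt ha
    refine ⟨[], p, startPos v d, ⟨hm, Nat.succ_pos _⟩, ⟨_, rfl, ?_, ?_⟩, rfl, hp.not_lt hlt ha, ?_⟩
    · rwa [near_univ]
    · rw [mem_Ioo_iff_near d, near_univ, near_univ]
      exact ⟨hp.lt, lt_startPos_op hp.hasLetter.mem_Icc d⟩
    · simp [hE]
  · have hsub : S ⊆ Set.Icc 1 v.length := by
      rintro q' ⟨y, t, p', -, -, hq', -⟩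
      exact hq'.hasLetter.mem_Icc
    -- The ranker to be prolonged by `(d, a)` is the one whose value is last in `v`, although
    -- membership in `S` is decided in `u`.
    obtain ⟨q₀, ⟨y, t, p₀, ht, hp₀, hq₀, hlt⟩, hmax⟩ := exists_last d hsub hne
    have hb : nextBlocks d (y :: t) ≤ m := by
      rcases ht with ht | ⟨ht, rfl⟩
      · have := nextBlocks_le d (y :: t)
        have := ht.1
        rw [blocks_cons] at *
        omega
      · rw [nextBlocks_cons_of_eq rfl]
        exact ht.1
    have hl : (y :: t).length ≤ n := by
      rcases ht with ht | ⟨ht, -⟩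
      · exact ht.2
      · exact ht.2
    obtain ⟨I, hI, rfl⟩ := hp₀.zoom d
    obtain ⟨J, hJ, rfl⟩ := hq₀.zoom d
    obtain ⟨p, hp⟩ := exists_next (z := (d, a)) hlt ha
    have hpi := hp.not_lt hlt ha
    refine ⟨y :: t, p, near d J, ⟨hb, Nat.lt_succ_of_le hl⟩, ⟨I, hI, hp, ?_⟩,
      hJ.condensedAt_near, hpi, hmax⟩
    refine (mem_Ioo_iff_near d).2 ⟨hp.lt, ?_⟩
    refine Dir.lt_of_le_of_lt hpi ?_
    -- If the far boundary were not after `i`, then it would be `i` itself, which `hi` excludes, or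
    -- its ranker would belong to `S`. In the latter case its value in `v` lies beyond `q₀`, because
    -- the chosen ranker is condensed on `v` as well, and this contradicts maximality.
    by_contra hfar
    have hfu := hI.condensedAt_far
    have hfv := hJ.condensedAt_far
    have hfb := blocks_farPrefix_lt (y :: t) d
    have hfl := length_farPrefix_le (y :: t) d
    rcases hw : farPrefix (y :: t) d with _ | ⟨x, r⟩
    · rw [hw] at hfu
      rw [show near d.op I = _ from hfu] at hfar
      exact hfar (lt_startPos_op ha.mem_Icc d)
    · rw [hw] at hfu hfv hfb hfl
      rw [blocks_cons] at hfb
      simp only [List.length_cons] at hfl hl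
      have hx : InRk (m - 1) n x r := ⟨by omega, by omega⟩
      rcases d.lt_or_eq_or_gt i (near d.op I) with hc | hc | hc
      · exact hfar hc
      · exact hi x r hx (hc ▸ hfu)
      · refine hmax (near d.op J) ⟨x, r, near d.op I, .inl hx, hfu, hfv, hc⟩ ?_
        obtain ⟨J', q', -, -, hq', rfl⟩ := hJ
        rw [near_cut, near_op_cut]
        exact ((mem_Ioo_iff_near d).1 hq').2

/-- A position named by a ranker with fewer blocks is answered by name. Any other new position is
approximated in the direction that leads from it to the old pebble: the approximating ranker is then
before the old pebble in `u`, and `lt` carries this over to `v`. Rankers before `i'` are controlled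
by the maximality of the approximation, the remaining ones by `Agree.order`. -/
theorem Similar.reply {m n : ℕ} (hm : 1 ≤ m) {u v : List A} (h : Agree m (n + 1) u v) {i j : ℕ}
    (hij : Similar m (n + 1) u i v j) {i' : ℕ} (hi' : i' ∈ Set.Icc 1 u.length) :
    ∃ j' ∈ Set.Icc 1 v.length, SameSide i i' j j' ∧ Similar m n u i' v j' := by
  by_cases hpt : ∃ (z : Dir × A) (s : RankerWord A), InRk (m - 1) n z s ∧
      CondensedAt u (z :: s) z.1 i'
  · obtain ⟨z, s, hs, hu⟩ := hpt
    have hs' : InRk m (n + 1) z s := hs.mono (by omega) (by omega)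
    obtain ⟨j', hv⟩ := (h.condensed z s hs').1 ⟨i', hu⟩
    have key : ∀ (y : Dir × A) (t : RankerWord A) (p q : ℕ), InRk m n y t →
        CondensedAt u (y :: t) y.1 p → CondensedAt v (y :: t) y.1 q → SameSide p i' q j' :=
      fun y t p q ht hp hq => h.order y z t s p q i' j' (ht.mono le_rfl (by omega))
        (.inl hs) hp hq hu hv
    refine ⟨j', hv.hasLetter.mem_Icc, hij.sides z s i' j' (hs.mono le_rfl (by omega)) hu hv,
      sameLetters_of_hasLetter hu.hasLetter hv.hasLetter, fun y t p q ht hp hq => ?_,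
      fun y t p q ht hp hq => ?_⟩
    · have := key y t p q (ht.mono (by omega) le_rfl) hp hq
      exact ⟨this.2, this.1⟩
    · exact ((sameSide_iff_of_lt y.1).1 (key y t p q ht hp hq)).1.1
  push Not at hpt
  obtain ⟨a, ha⟩ := exists_hasLetter hi'
  have move : ∀ d : Dir, d.lt i' i →
      ∃ j' ∈ Set.Icc 1 v.length, SameSide i i' j j' ∧ Similar m n u i' v j' := by
    intro d hd
    obtain ⟨s, p, q, hs, hp, hq, hip, hmax⟩ := exists_condensed_approximation hm h ha hpt d
    have hqj : d.lt q j := hij.lt (d, a) s p q hs hp hq (Dir.lt_of_le_of_lt hip hd)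
    refine ⟨q, hq.hasLetter.mem_Icc, sameSide_of_lt (d := d.op) (Dir.lt_op.2 hd) (Dir.lt_op.2 hqj),
      sameLetters_of_hasLetter ha hq.hasLetter, fun y t p' q' ht hp' hq' => ?_,
      fun y t p' q' ht hp' hq' hlt => ?_⟩
    · rcases d.lt_or_eq_or_gt i' p' with hc | rfl | hc
      · refine sameSide_of_lt hc ?_
        have := h.order (d, a) y s t p q p' q' hs (.inl ht) hp hq hp' hq'
        exact ((sameSide_iff_of_lt d).1 this).1.1 (Dir.lt_of_le_of_lt hip hc)
      · exact absurd hp' (hpt y t ht)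
      · exact sameSide_of_lt (d := d.op) (Dir.lt_op.2 hc)
          (Dir.lt_op.2 (hmax y t p' q' (.inl ht) hp' hq' hc))
    · by_cases hy : y.1 = d
      · rw [hy] at hlt ⊢
        exact hmax y t p' q' (.inr ⟨ht, hy⟩) hp' hq' hlt
      · have := h.order (d, a) y s t p q p' q' hs (.inr ⟨ht, hy⟩) hp hq hp' hq'
        rw [Dir.eq_op_of_ne hy, Dir.lt_op] at hlt ⊢
        exact ((sameSide_iff_of_lt d).1 this).1.1 (Dir.lt_of_le_of_lt hip hlt)
  rcases lt_trichotomy i' i with hlt | rfl | hlt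
  · exact move .X hlt
  -- If Spoiler stays, so does Duplicator; `j` is a position of `v` because it carries a letter.
  · exact ⟨j, ((hij.letters a).1 ha).mem_Icc, by unfold SameSide; omega, hij.mono (by omega)⟩
  · exact move .Y hlt

theorem Similar.sim {m n : ℕ} (hm : 1 ≤ m) {u v : List A} (h : Agree m n u v) {i j : ℕ}
    (hij : Similar m n u i v j) : Sim m n u i v j := by
  induction n generalizing m u v i j with
  | zero => exact hij.letters
  | succ n ih =>
    refine ⟨hij.letters, fun i' hi' => ?_, fun hm' j' hj' => ?_⟩
    · obtain ⟨j', hj', hs, hsim⟩ := hij.reply hm h hi'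
      exact ⟨j', hj', hs, ih hm (h.mono le_rfl (by omega)) hsim⟩
    · have h' : Agree (m - 1) (n + 1) v u := h.symm.mono (by omega) le_rfl
      obtain ⟨i', hi', hs, hsim⟩ := hij.switch.reply (by omega) h' hj'
      exact ⟨i', hi', hs, ih (by omega) (h'.mono le_rfl (by omega)) hsim⟩

theorem Agree.sim {m n : ℕ} (hm : 1 ≤ m) {u v : List A} (h : Agree m n u v) :
    Sim m n u 0 v 0 := by
  refine Similar.sim hm h ⟨fun a => by simp [HasLetter], fun z s p q _ hp hq => ?_,
    fun z s p q _ hp hq => ?_⟩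
  all_goals
    have h₁ := hp.hasLetter.mem_Icc.1
    have h₂ := hq.hasLetter.mem_Icc.1
  · unfold SameSide; omega
  · obtain ⟨_ | _, a⟩ := z <;> simp only [Dir.lt] <;> omega

theorem agree_iff_sim {m n : ℕ} (hm : 1 ≤ m) {u v : List A} :
    Sim m n u 0 v 0 ∧ Sim m n v 0 u 0 ↔ Agree m n u v := by
  refine ⟨fun h => ⟨fun z s hs => ⟨?_, ?_⟩, fun z y s t p q p' q' hs ht hp hq hp' hq' => ?_⟩,
    fun h => ⟨h.sim hm, h.symm.sim hm⟩⟩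
  · rintro ⟨p, hp⟩
    exact exists_condensedAt_of_sim h.1 hs.1 hs.2 hp
  · rintro ⟨p, hp⟩
    exact exists_condensedAt_of_sim h.2 hs.1 hs.2 hp
  · refine sameSide_of_sim h.1 h.2 hs.1 hs.2 ?_ ?_ hp.at hq.at hp'.at hq'.at
    · have := one_le_nextBlocks y.1 t
      exact ht.imp (fun h => by have := h.1; omega) fun h => ⟨h.1.1, h.2⟩
    · have := ht.elim (fun h => h.2) fun h => h.1.2
      omega

/-! ### Rankers, read forwards -/

theorem blockCount_append_pair {α : Type*} [DecidableEq α] (l : List α) (a b : α) :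
    blockCount (l ++ [a, b]) = blockCount (l ++ [a]) + if a = b then 0 else 1 := by
  induction l with
  | nil => simp only [List.nil_append, blockCount]; split <;> rfl
  | cons c l ih =>
    rcases l with _ | ⟨c', l⟩
    · simp only [List.cons_append, List.nil_append, blockCount]
      split_ifs <;> rfl
    · simp only [List.cons_append, blockCount] at ih ⊢
      rw [ih]
      split_ifs <;> omega

theorem blockCount_reverse {α : Type*} [DecidableEq α] (l : List α) :
    blockCount l.reverse = blockCount l := by
  induction l with
  | nil => rfl
  | cons a l ih =>
    rcases l with _ | ⟨b, l⟩
    · rfl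
    · rw [List.reverse_cons, List.reverse_cons, List.append_assoc, List.singleton_append,
        blockCount_append_pair, ← List.reverse_cons, ih]
      simp only [blockCount, eq_comm (a := a)]
      split_ifs <;> rfl

theorem cons_reverse_mem_rankers {m n : ℕ} {z : Dir × A} {s : RankerWord A} :
    (z :: s).reverse ∈ rankers A m n ↔ InRk m n z s := by
  simp only [rankers, Set.mem_ofPred_eq, List.map_reverse, blockCount_reverse, List.length_reverse,
    List.length_cons, InRk, nextBlocks, List.map_cons, Nat.succ_le_iff]
  simp

theorem at_reverse_append_iff {u : List A} (r s : RankerWord A) (z : Dir × A) (p : ℕ) (d : Dir) :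
    At u ((z :: r).reverse ++ s) d p ↔ ∃ q, At u s z.1 q ∧ Reaches u (z :: r) q p := by
  induction r generalizing s z with
  | nil => simp [At, Reaches]
  | cons y r ih =>
    rw [List.reverse_cons, List.append_assoc, List.singleton_append, ih]
    simp only [At, Reaches]
    constructor
    · rintro ⟨q, ⟨q₀, h₁, h₂⟩, h₃⟩
      exact ⟨q₀, h₁, q, h₂, h₃⟩
    · rintro ⟨q₀, h₁, q, h₂, h₃⟩
      exact ⟨q, ⟨q₀, h₁, h₂⟩, h₃⟩

theorem defines_iff_at {u : List A} {r : RankerWord A} (hr : r ≠ []) {p : ℕ} {d : Dir} :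
    Defines u r p ↔ At u r.reverse d p := by
  obtain _ | ⟨z, r⟩ := r
  · exact absurd rfl hr
  rw [← List.append_nil (z :: r).reverse, at_reverse_append_iff]
  obtain ⟨_ | _, a⟩ := z <;> simp [At, Defines, startPos]

theorem zoomStep_iff {u : List A} {z : Dir × A} {d : Dir} {I J : ℕ × ℕ} :
    ZoomStep u z d I J ↔ ∃ p, Next u z (near z.1 I) p ∧ J = cut d p I := by
  obtain ⟨i, j⟩ := I
  obtain ⟨i', j'⟩ := J
  obtain ⟨_ | _, a⟩ := z <;> cases d <;> simp [ZoomStep, near, cut, and_comm]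

/-- If `e = d`, the point `x` of the new interval lies beyond `p`, which keeps `p` inside `I`. If
not, strictness of the inclusion does, through a point of `I` that is cut off. -/
theorem mem_Ioo_of_cut_ssubset {d e : Dir} {p x : ℕ} {I : ℕ × ℕ} (hp : e.lt (near e I) p)
    (hx : x ∈ Set.Ioo (cut d p I).1 (cut d p I).2)
    (h : Set.Ioo (cut d p I).1 (cut d p I).2 ⊂ Set.Ioo I.1 I.2) : p ∈ Set.Ioo I.1 I.2 := by
  obtain ⟨i, j⟩ := I
  obtain ⟨y, hy, hy'⟩ := Set.exists_of_ssubset h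
  cases d <;> cases e <;> simp only [cut, near, Dir.lt, Set.mem_Ioo] at * <;> omega

theorem cut_ssubset {d : Dir} {p : ℕ} {I : ℕ × ℕ} (hp : p ∈ Set.Ioo I.1 I.2) :
    Set.Ioo (cut d p I).1 (cut d p I).2 ⊂ Set.Ioo I.1 I.2 := by
  refine (Set.ssubset_iff_of_subset fun x hx => ?_).2 ⟨p, hp, fun h => ?_⟩ <;>
    cases d <;> simp only [cut, Set.mem_Ioo] at * <;> omega

theorem reverse_take_succ {α : Type*} {r : List α} {l : ℕ} (h : l < r.length) :
    (r.take (l + 1)).reverse = r[l] :: (r.take l).reverse := by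
  rw [List.take_succ_eq_append_getElem h, List.reverse_append]
  rfl

theorem Zoom.of_append {u : List A} {s t : RankerWord A} {z : Dir × A} {d : Dir} {I : ℕ × ℕ}
    (h : Zoom u (s ++ z :: t) d I) : ∃ J, Zoom u t z.1 J := by
  induction s generalizing d I with
  | nil => obtain ⟨J, -, hJ, -⟩ := h; exact ⟨J, hJ⟩
  | cons y s ih => obtain ⟨J, -, hJ, -⟩ := h; exact ih hJ

theorem reverse_eq_getElem_cons {α : Type*} {r : List α} (hr : r ≠ []) :
    r.reverse = r[r.length - 1]'(Nat.sub_one_lt (by simpa using hr)) ::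
      (r.take (r.length - 1)).reverse := by
  have hlen : 0 < r.length := List.length_pos_iff.2 hr
  rw [← reverse_take_succ, Nat.sub_add_cancel hlen, List.take_length]

/-- The rules determine each interval from the preceding one, so the chain exists exactly when the
recursion `Zoom` succeeds on every prefix. The condition that a step stays inside its interval
corresponds to strict inclusion, given that the last interval contains the value. -/
theorem isCondensed_iff {u : List A} {r : RankerWord A} (hr : r ≠ []) {d : Dir} :
    IsCondensed u r ↔ ∃ p, CondensedAt u r.reverse d p := by
  have hlen : 0 < r.length := List.length_pos_iff.2 hr
  constructor
  · rintro ⟨p, hp, I, hI₀, hI, hpI⟩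
    have sub : ∀ l k, l + k = r.length - 1 → p ∈ Set.Ioo (I l).1 (I l).2 := by
      intro l k
      induction k generalizing l with
      | zero => rintro h; rw [show l = r.length - 1 by omega]; exact hpI
      | succ k ih =>
        intro h
        exact (hI l (by omega)).1.subset (ih (l + 1) (by omega))
    have zoom : ∀ (l : ℕ) (hl : l < r.length), Zoom u (r.take l).reverse r[l].1 (I l) := by
      intro l
      induction l with
      | zero => exact fun _ => hI₀
      | succ l ih =>
        intro hl
        obtain ⟨hss, hst⟩ := hI l hl
        obtain ⟨q, hq, hcut⟩ := zoomStep_iff.1 hst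
        rw [reverse_take_succ (by omega)]
        have hp' := sub (l + 1) (r.length - 1 - (l + 1)) (by omega)
        rw [hcut] at hp' hss
        exact ⟨I l, q, ih (by omega), hq, mem_Ioo_of_cut_ssubset hq.lt hp' hss, hcut⟩
    have hz := zoom (r.length - 1) (by omega)
    rw [defines_iff_at (d := d) hr, reverse_eq_getElem_cons hr] at hp
    obtain ⟨q, hq, hn⟩ := hp
    obtain rfl := hq.unique hz.at_near
    rw [reverse_eq_getElem_cons hr]
    exact ⟨p, _, hz, hn, hpI⟩
  · rintro ⟨p, hp⟩
    refine ⟨p, (defines_iff_at hr).2 hp.at, ?_⟩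
    rw [reverse_eq_getElem_cons hr] at hp
    obtain ⟨K, hK, hn, hpK⟩ := hp
    have ex : ∀ l (hl : l < r.length), ∃ I, Zoom u (r.take l).reverse r[l].1 I := by
      intro l hl
      rcases Nat.lt_or_ge l (r.length - 1) with h | h
      · have hsplit : (r.take (r.length - 1)).reverse =
            ((r.take (r.length - 1)).drop (l + 1)).reverse ++ r[l] :: (r.take l).reverse := by
          rw [← reverse_take_succ hl, ← List.reverse_append]
          conv_lhs => rw [← List.take_append_drop (l + 1) (r.take (r.length - 1))]
          rw [List.take_take, min_eq_left (by omega)]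
        rw [hsplit] at hK
        exact hK.of_append
      · obtain rfl : l = r.length - 1 := by omega
        exact ⟨K, hK⟩
    -- Beyond the length of `r` the intervals are arbitrary; no condition refers to them.
    choose! I hI using ex
    refine ⟨I, hI 0 hlen, fun l hl => ?_, ?_⟩
    · have h := hI (l + 1) hl
      rw [reverse_take_succ (by omega)] at h
      obtain ⟨J, q, hJ, hq, hqJ, hcut⟩ := h
      obtain rfl := hJ.unique (hI l (by omega))
      rw [hcut]
      exact ⟨cut_ssubset hqJ, zoomStep_iff.2 ⟨q, hq, rfl⟩⟩
    · rwa [(hI _ (by omega)).unique hK]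

/-! ### Translation into the three conditions on rankers -/

theorem compare_eq_compare_iff {i i' j j' : ℕ} :
    compare i i' = compare j j' ↔ SameSide i i' j j' := by
  unfold SameSide
  rcases lt_trichotomy i i' with h | h | h <;> rcases lt_trichotomy j j' with h' | h' | h' <;>
    simp only [compare_lt_iff_lt.2, compare_gt_iff_gt.2, compare_eq_iff_eq.2, h, h', reduceCtorEq] <;>
    simp <;> omega

theorem sameOrd_iff {u v : List A} {z y : Dir × A} {s t : RankerWord A} {p q p' q' : ℕ}
    (hp : CondensedAt u (z :: s) z.1 p) (hq : CondensedAt v (z :: s) z.1 q)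
    (hp' : CondensedAt u (y :: t) y.1 p') (hq' : CondensedAt v (y :: t) y.1 q') :
    SameOrd u v (z :: s).reverse (y :: t).reverse ↔ SameSide p p' q q' := by
  have hd : ∀ {w : List A} {x : Dir × A} {r : RankerWord A} {k l : ℕ},
      CondensedAt w (x :: r) x.1 k → (Defines w (x :: r).reverse l ↔ l = k) := by
    intro w x r k l hk
    rw [defines_iff_at (d := x.1) (by simp), List.reverse_reverse]
    exact ⟨fun h => h.unique hk.at, fun h => h ▸ hk.at⟩
  simp only [SameOrd, hd hp, hd hq, hd hp', hd hq', compare_eq_compare_iff]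
  exact ⟨fun h => h p p' q q' rfl rfl rfl rfl, by rintro h _ _ _ _ rfl rfl rfl rfl; exact h⟩

theorem forall_mem_rankers {m n : ℕ} {P : RankerWord A → Prop} :
    (∀ r ∈ rankers A m n, P r) ↔ ∀ z s, InRk m n z s → P (z :: s).reverse := by
  refine ⟨fun h z s hs => h _ (cons_reverse_mem_rankers.2 hs), fun h r hr => ?_⟩
  obtain ⟨s, rfl⟩ : ∃ s, r = s.reverse := ⟨r.reverse, r.reverse_reverse.symm⟩
  obtain _ | ⟨z, s⟩ := s
  · exact absurd rfl hr.1
  · exact h z s (cons_reverse_mem_rankers.1 hr)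

theorem endDifferently_iff {z y : Dir × A} {s t : RankerWord A} :
    EndDifferently (z :: s).reverse (y :: t).reverse ↔ y.1 ≠ z.1 := by
  simp [EndDifferently, ne_comm]

theorem isCondensed_reverse_iff {u : List A} {z : Dir × A} {s : RankerWord A} :
    IsCondensed u (z :: s).reverse ↔ ∃ p, CondensedAt u (z :: s) z.1 p := by
  rw [isCondensed_iff (d := z.1) (by simp), List.reverse_reverse]

theorem agree_iff {m n : ℕ} {u v : List A} :
    Agree m n u v ↔
      (∀ r ∈ rankers A m n, (IsCondensed u r ↔ IsCondensed v r)) ∧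
      (∀ r ∈ rankers A m n, ∀ r' ∈ rankers A (m - 1) (n - 1),
        IsCondensed u r → IsCondensed v r → IsCondensed u r' → IsCondensed v r' →
        SameOrd u v r r') ∧
      (∀ r ∈ rankers A m n, ∀ r' ∈ rankers A m (n - 1),
        IsCondensed u r → IsCondensed v r → IsCondensed u r' → IsCondensed v r' →
        EndDifferently r r' → SameOrd u v r r') := by
  simp only [forall_mem_rankers, isCondensed_reverse_iff, endDifferently_iff]
  constructor
  · refine fun h => ⟨h.condensed, ?_, ?_⟩
    · rintro z s hs y t ht ⟨p, hp⟩ ⟨q, hq⟩ ⟨p', hp'⟩ ⟨q', hq'⟩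
      rw [sameOrd_iff hp hq hp' hq']
      exact h.order z y s t p q p' q' hs (.inl ht) hp hq hp' hq'
    · rintro z s hs y t ht ⟨p, hp⟩ ⟨q, hq⟩ ⟨p', hp'⟩ ⟨q', hq'⟩ hne
      rw [sameOrd_iff hp hq hp' hq']
      exact h.order z y s t p q p' q' hs (.inr ⟨ht, hne⟩) hp hq hp' hq'
  · rintro ⟨h₁, h₂, h₃⟩
    refine ⟨h₁, fun z y s t p q p' q' hs ht hp hq hp' hq' => ?_⟩
    rw [← sameOrd_iff hp hq hp' hq']
    rcases ht with ht | ⟨ht, hne⟩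
    · exact h₂ z s hs y t ht ⟨p, hp⟩ ⟨q, hq⟩ ⟨p', hp'⟩ ⟨q', hq'⟩
    · exact h₃ z s hs y t ht ⟨p, hp⟩ ⟨q, hq⟩ ⟨p', hp'⟩ ⟨q', hq'⟩ hne

end CondensedRanker

theorem mainTheorem4 {A : Type*} (u v : List A) (m n : ℕ) (hm : 1 ≤ m) (hmn : m ≤ n) :
    (∀ φ ∈ CondensedRanker.FO2 A m n,
      (CondensedRanker.Satisfies u φ ↔ CondensedRanker.Satisfies v φ)) ↔
    ((∀ r ∈ CondensedRanker.rankers A m n,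
        (CondensedRanker.IsCondensed u r ↔ CondensedRanker.IsCondensed v r)) ∧
      (∀ r ∈ CondensedRanker.rankers A m n, ∀ r' ∈ CondensedRanker.rankers A (m - 1) (n - 1),
        CondensedRanker.IsCondensed u r → CondensedRanker.IsCondensed v r →
        CondensedRanker.IsCondensed u r' → CondensedRanker.IsCondensed v r' →
        CondensedRanker.SameOrd u v r r') ∧
      (∀ r ∈ CondensedRanker.rankers A m n, ∀ r' ∈ CondensedRanker.rankers A m (n - 1),
        CondensedRanker.IsCondensed u r → CondensedRanker.IsCondensed v r →
        CondensedRanker.IsCondensed u r' → CondensedRanker.IsCondensed v r' →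
        CondensedRanker.EndDifferently r r' →
        CondensedRanker.SameOrd u v r r')) :=
  (CondensedRanker.equiv_iff_sim hm).trans
    ((CondensedRanker.agree_iff_sim hm).trans CondensedRanker.agree_iff)
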